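/- **Setting.** Let $G$ be a finite-dimensional real Lie group with Lie algebra $\mathfrak g$ and let $\langle\cdot,\cdot\rangle$ be a nondegenerate symmetric bilinear form on $\mathfrak g$ (not necessarily ad-invariant). Let $\mathfrak g=\mathfrak g_+\oplus\mathfrak g_-$ (direct sum of vector spaces) with Lie subalgebras $\mathfrak g_\pm$, and let $G_\pm$ be Lie subgroups of $G$ (injectively immersed) with Lie algebras $\mathfrak g_\pm$. For $X\in\mathfrak g$ let $\mathrm{ad}^t_X$ be defined by $\langle \mathrm{ad}^t_XY,Z\rangle=\langle Y,[X,Z]\rangle$; for $g\in G$ let $\tau(g)$ be defined by $\langle\tau(g)X,Y\rangle=\langle X,\mathrm{Ad}(g^{-1})Y\rangle$. For a smooth $f:\mathfrak g\to\mathbb R$ let $\nabla f(U)$ be defined by $\langle\nabla f(U),Y\rangle=df_U(Y)$, and let $\nabla f_+(U)\in\mathfrak g_+$, $\nabla f_-(U)\in\mathfrak g_-$ be its components. Call $f$ $\tau$-invariant if $f(\tau(g)U)=f(U)$ for all $g\in G$, $U\in\mathfrak g$. One has $\mathfrak g=\mathfrak g_+^\perp\oplus\mathfrak g_-^\perp$,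 with projection $\pi_{\mathfrak g_+^\perp}$ onto the first summand. The isomorphism $\mathfrak g_+^\perp\to\mathfrak g_-^*$, $X\mapsto\langle X,\cdot\rangle|_{\mathfrak g_-}$, transports the coadjoint action of $G_-$ on $\mathfrak g_-^*$ to an action $\tilde\tau$ of $G_-$ on $\mathfrak g_+^\perp$; for $Y\in\mathfrak g_-$ put $\tilde Y(U)=\frac{d}{ds}\big|_{s=0}\tilde\tau(\exp sY)U$. Let $\mathcal M\subset\mathfrak g_+^\perp$ be a $G_-$-orbit; its tangent space at $U$ is spanned by the vectors $\tilde Y(U)$, $Y\in\mathfrak g_-$, and its orbit symplectic form $\omega$ is the (well defined, alternating and nondegenerate) form $\omega_U(\tilde Y,\tilde Z)=\langle U,[Y,Z]\rangle$. The Hamiltonian vector field $X_H$ of a smooth function $H$ on $\mathcal M$ is defined by $dH_U(v)=\omega_U(v,X_H(U))$ for all $v\in T_U\mathcal M$, and $\{H_1,H_2\}=\omega(X_{H_1},X_{H_2})$. **Theorem.** Let $f:\mathfrak g\to\mathbb R$ be smooth and $H=f|_{\mathcal M}$. 1. For every $U\in\mathcal M$ there is exactly one Hamiltonian vector $X_H(U)$,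 and $$X_H(U)=-\widetilde{\nabla f_-(U)}(U)=\pi_{\mathfrak g_+^\perp}\big(\mathrm{ad}^t_{\nabla f_-(U)}U\big).$$ 2. If $f$ is $\tau$-invariant, then $X_H(U)=-\mathrm{ad}^t_{\nabla f_+(U)}U=\mathrm{ad}^t_{\nabla f_-(U)}U$ for all $U\in\mathcal M$; that is, the Hamiltonian equation for $H$ is $$\frac{du}{ds}=-\mathrm{ad}^t_{\nabla f_+(u)}u=\mathrm{ad}^t_{\nabla f_-(u)}u .$$ 3. If $f_1,f_2:\mathfrak g\to\mathbb R$ are smooth and $\tau$-invariant and $H_i=f_i|_{\mathcal M}$, then $\{H_1,H_2\}=0$ on $\mathcal M$. 4. Suppose that the multiplication map $G_+\times G_-\to G$, $(g_+,g_-)\mapsto g_+g_-$, is a diffeomorphism and that $f$ is $\tau$-invariant. Let $U_0\in\mathcal M$. For every $s\in\mathbb R$ there is exactly one factorization $\exp(s\nabla f(U_0))=g_+(s)g_-(s)$ with $g_\pm(s)\in G_\pm$. The initial value problem $$\frac{du}{ds}=-\mathrm{ad}^t_{\nabla f_+(u)}u,\qquad u(0)=U_0,$$ has the global solution $$u(s)=\tau\big(g_+(-s)^{-1}\big)U_0,\qquad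 s\in\mathbb R.$$ This solution stays in $\mathcal M$, and on every open interval around $0$ it is the only solution with values in $\mathfrak g$. -/

import Mathlib

open scoped Manifold ContDiff Topology

noncomputable section

namespace Transadjoint

section LieGroups

variable {E : Type*} [NormedAddCommGroup E] [NormedSpace ℝ E]
  {G : Type*} [TopologicalSpace G] [ChartedSpace E G] [Group G]

/-- The Lie algebra of `G`: the tangent space at the identity, with the bracket of left invariant
vector fields. -/
abbrev LieAlg (E : Type*) [NormedAddCommGroup E] [NormedSpace ℝ E]
    (G : Type*) [TopologicalSpace G] [ChartedSpace E G] [Group G] : Type _ :=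
  GroupLieAlgebra 𝓘(ℝ, E) G

instance instFiniteDimensionalLieAlg [FiniteDimensional ℝ E] :
    FiniteDimensional ℝ (LieAlg E G) :=
  inferInstanceAs (FiniteDimensional ℝ E)

/-- `c` is the integral curve, through the identity, of the left invariant vector field of `X`. -/
def IsOneParam (X : LieAlg E G) (c : ℝ → G) : Prop :=
  c 0 = 1 ∧ IsMIntegralCurve c (mulInvariantVectorField (I := 𝓘(ℝ, E)) X)

/-- The exponential map of `G`: the value at time `1` of the integral curve through the identity
of the left invariant vector field of `X`. -/
def exp (X : LieAlg E G) : G :=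
  Classical.epsilon fun g : G => ∃ c : ℝ → G, IsOneParam X c ∧ c 1 = g

/-- The adjoint representation: `Ad g` is the differential at the identity of `h ↦ g h g⁻¹`.
(All tangent spaces of `G` are by definition copies of the model space, so that the tangent space
at `g * 1 * g⁻¹` is literally the one at `1`.) -/
def Ad (g : G) : LieAlg E G →ₗ[ℝ] LieAlg E G :=
  ContinuousLinearMap.toLinearMap (M := LieAlg E G) (M₂ := LieAlg E G)
    (mfderiv 𝓘(ℝ, E) 𝓘(ℝ, E) (fun h : G => g * h * g⁻¹) (1 : G))

/-- The coadjoint representation, `(Ad* g) φ = φ ∘ Ad g⁻¹`. -/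
def coAd (g : G) (φ : Module.Dual ℝ (LieAlg E G)) : Module.Dual ℝ (LieAlg E G) :=
  φ ∘ₗ Ad g⁻¹

variable {F : Type*} [NormedAddCommGroup F] [NormedSpace ℝ F]
  {K : Type*} [TopologicalSpace K] [ChartedSpace F K] [Group K]

/-- The differential at the identity of a group homomorphism. -/
def differential (ι : K →* G) : LieAlg F K →ₗ[ℝ] LieAlg E G :=
  ContinuousLinearMap.toLinearMap (M := LieAlg F K) (M₂ := LieAlg E G)
    (mfderiv 𝓘(ℝ, F) 𝓘(ℝ, E) ι (1 : K))

/-- Smooth real valued functions on the Lie algebra. -/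
def IsSmooth (f : LieAlg E G → ℝ) : Prop := ContDiff ℝ ∞ (fun x : E => f x)

variable [CompleteSpace E] [LieGroup 𝓘(ℝ, E) ∞ G]

instance instLieGroupMinSmoothness : LieGroup 𝓘(ℝ, E) (minSmoothness ℝ 3) G :=
  LieGroup.of_le (n := ∞) (by simpa using (WithTop.coe_le_coe.2 le_top : ((3 : ℕ∞) : WithTop ℕ∞) ≤ ∞))

/-- `ι : K → G` exhibits `K` as an (immersed) Lie subgroup of `G` with Lie algebra `𝔥`. -/
structure IsLieSubgroup (ι : K →* G) (𝔥 : LieSubalgebra ℝ (LieAlg E G)) : Prop where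
  contMDiff : ContMDiff 𝓘(ℝ, F) 𝓘(ℝ, E) ∞ ι
  injective : Function.Injective ι
  differential_injective : Function.Injective (differential (E := E) (F := F) ι)
  range_differential : LinearMap.range (differential (E := E) (F := F) ι) = 𝔥.toSubmodule

section Form

variable [FiniteDimensional ℝ E] {B : LinearMap.BilinForm ℝ (LieAlg E G)} (hB : B.Nondegenerate)

/-- The transpose of `ad X`: `⟨adᵗ_X Y, Z⟩ = ⟨Y, [X, Z]⟩`. -/
def adT (X : LieAlg E G) : LieAlg E G →ₗ[ℝ] LieAlg E G :=
  B.leftAdjointOfNondegenerate hB (LieAlgebra.ad ℝ (LieAlg E G) X)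

/-- The transadjoint representation: `⟨τ(g) X, Y⟩ = ⟨X, Ad(g⁻¹) Y⟩`. -/
def tau (g : G) : LieAlg E G →ₗ[ℝ] LieAlg E G :=
  B.leftAdjointOfNondegenerate hB (Ad g⁻¹)

/-- The gradient: `⟨∇f(U), Y⟩ = df_U(Y)`. -/
def grad (f : LieAlg E G → ℝ) (U : LieAlg E G) : LieAlg E G :=
  (B.toDual hB).symm (fderiv ℝ f U : LieAlg E G →ₗ[ℝ] ℝ)

/-- `τ`-invariance of a function. -/
def IsTauInvariant (f : LieAlg E G → ℝ) : Prop :=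
  ∀ (g : G) (U : LieAlg E G), f (tau hB g U) = f U

end Form

end LieGroups

/-- A nondegenerate symmetric bilinear form on the Lie algebra `𝔤` of `G`, a decomposition
`𝔤 = 𝔤₊ ⊕ 𝔤₋` into Lie subalgebras, and a Lie subgroup `G₋` of `G` with Lie algebra `𝔤₋`. -/
structure Splitting
    (E : Type*) [NormedAddCommGroup E] [NormedSpace ℝ E] [CompleteSpace E]
    (G : Type*) [TopologicalSpace G] [ChartedSpace E G] [Group G] [LieGroup 𝓘(ℝ, E) ∞ G]
    (Em : Type*) [NormedAddCommGroup Em] [NormedSpace ℝ Em]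
    (Gm : Type*) [TopologicalSpace Gm] [ChartedSpace Em Gm] [Group Gm] where
  /-- the bilinear form -/
  form : LinearMap.BilinForm ℝ (LieAlg E G)
  symm : form.IsSymm
  nondeg : form.Nondegenerate
  /-- `𝔤₊` -/
  gp : LieSubalgebra ℝ (LieAlg E G)
  /-- `𝔤₋` -/
  gm : LieSubalgebra ℝ (LieAlg E G)
  isCompl : IsCompl gp.toSubmodule gm.toSubmodule
  /-- the inclusion of `G₋` in `G` -/
  incl : Gm →* G
  isLieSubgroup : IsLieSubgroup (F := Em) incl gm

namespace Splitting

variable {E : Type*} [NormedAddCommGroup E] [NormedSpace ℝ E] [FiniteDimensional ℝ E]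
  [CompleteSpace E]
  {G : Type*} [TopologicalSpace G] [ChartedSpace E G] [Group G] [LieGroup 𝓘(ℝ, E) ∞ G]
  {Em : Type*} [NormedAddCommGroup Em] [NormedSpace ℝ Em] [FiniteDimensional ℝ Em]
  {Gm : Type*} [TopologicalSpace Gm] [ChartedSpace Em Gm] [Group Gm]
  (D : Splitting E G Em Gm)

/-- `𝔤₊^⊥` -/
abbrev gpPerp : Submodule ℝ (LieAlg E G) := D.form.orthogonal D.gp.toSubmodule

/-- `𝔤₋^⊥` -/
abbrev gmPerp : Submodule ℝ (LieAlg E G) := D.form.orthogonal D.gm.toSubmodule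

/-- The differential of the inclusion, an isomorphism of the Lie algebra of `G₋` onto `𝔤₋`. -/
abbrev dIncl : LieAlg Em Gm →ₗ[ℝ] LieAlg E G := differential (E := E) (F := Em) D.incl

theorem isCompl_perp : IsCompl D.gpPerp D.gmPerp := by
  have hdisj : Disjoint D.gpPerp D.gmPerp := by
    rw [Submodule.disjoint_def]
    intro x hp hm
    refine D.nondeg.2 x fun y => ?_
    obtain ⟨a, ha, b, hb, rfl⟩ := Submodule.mem_sup.1
      (D.isCompl.sup_eq_top ▸ Submodule.mem_top : y ∈ D.gp.toSubmodule ⊔ D.gm.toSubmodule)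
    have h1 : D.form a x = 0 := hp a ha
    have h2 : D.form b x = 0 := hm b hb
    simp [h1, h2]
  refine (Submodule.isCompl_iff_disjoint _ _ ?_).2 hdisj
  have h1 := LinearMap.BilinForm.finrank_orthogonal D.nondeg D.gp.toSubmodule
  have h2 := LinearMap.BilinForm.finrank_orthogonal D.nondeg D.gm.toSubmodule
  have h3 := Submodule.finrank_add_eq_of_isCompl D.isCompl
  change Module.finrank ℝ D.gpPerp = _ at h1
  change Module.finrank ℝ D.gmPerp = _ at h2
  omega

/-- `X ↦ ℓ_X`, `ℓ_X(Y) = ⟨X, Y⟩`, from `𝔤₊^⊥` to the dual of the Lie algebra of `G₋`. -/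
def ell : D.gpPerp →ₗ[ℝ] Module.Dual ℝ (LieAlg Em Gm) where
  toFun X := (D.form X) ∘ₗ D.dIncl
  map_add' X Y := by ext; simp
  map_smul' c X := by ext; simp

theorem ell_bijective : Function.Bijective D.ell := by
  have hinj : Function.Injective D.ell := by
    rw [injective_iff_map_eq_zero]
    intro X hX
    apply Subtype.ext
    refine D.nondeg.2 _ fun y => ?_
    obtain ⟨a, ha, b, hb, rfl⟩ := Submodule.mem_sup.1
      (D.isCompl.sup_eq_top ▸ Submodule.mem_top : y ∈ D.gp.toSubmodule ⊔ D.gm.toSubmodule)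
    rw [← D.isLieSubgroup.range_differential] at hb
    obtain ⟨Y, rfl⟩ := hb
    have h1 : D.form a X = 0 := X.2 a ha
    have h2 : D.form X (D.dIncl Y) = 0 := LinearMap.congr_fun hX Y
    rw [D.symm.eq] at h2
    rw [map_add, LinearMap.add_apply, h1, zero_add]
    exact h2
  refine ⟨hinj, (LinearMap.injective_iff_surjective_of_finrank_eq_finrank ?_).1 hinj⟩
  have h1 := LinearMap.BilinForm.finrank_orthogonal D.nondeg D.gp.toSubmodule
  have h3 := Submodule.finrank_add_eq_of_isCompl D.isCompl
  have h4 := LinearMap.finrank_range_of_inj D.isLieSubgroup.differential_injective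
  rw [D.isLieSubgroup.range_differential] at h4
  change Module.finrank ℝ D.gpPerp = _ at h1
  rw [Subspace.dual_finrank_eq]
  omega

/-- The isomorphism of `𝔤₊^⊥` with the dual of the Lie algebra of `G₋`. -/
def ellEquiv : D.gpPerp ≃ₗ[ℝ] Module.Dual ℝ (LieAlg Em Gm) :=
  LinearEquiv.ofBijective D.ell D.ell_bijective

/-- The action of `G₋` on `𝔤₊^⊥` corresponding to the coadjoint action of `G₋`. -/
def tauTilde (g : Gm) (X : D.gpPerp) : D.gpPerp :=
  D.ellEquiv.symm (coAd g (D.ellEquiv X))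

/-- The `G₋`-orbit of a point of `𝔤₊^⊥`. -/
def orbit (P : D.gpPerp) : Set D.gpPerp := Set.range fun g : Gm => D.tauTilde g P

/-- The projection of `𝔤 = 𝔤₊^⊥ ⊕ 𝔤₋^⊥` onto `𝔤₊^⊥`. -/
def projPerp : LieAlg E G →ₗ[ℝ] LieAlg E G := D.gpPerp.projection D.gmPerp D.isCompl_perp

/-- The component in `𝔤₊` of the gradient, for `𝔤 = 𝔤₊ ⊕ 𝔤₋`. -/
def gradPlus (f : LieAlg E G → ℝ) (U : LieAlg E G) : LieAlg E G :=
  D.gp.toSubmodule.projection D.gm.toSubmodule D.isCompl (grad D.nondeg f U)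

/-- The component in `𝔤₋` of the gradient, for `𝔤 = 𝔤₊ ⊕ 𝔤₋`. -/
def gradMinus (f : LieAlg E G → ℝ) (U : LieAlg E G) : LieAlg E G :=
  D.gm.toSubmodule.projection D.gp.toSubmodule D.isCompl.symm (grad D.nondeg f U)

/-- The curve `s ↦ τ̃(exp sY) U` in the orbit of `U`. -/
def orbitCurve (Y : LieAlg Em Gm) (U : D.gpPerp) (s : ℝ) : LieAlg E G :=
  D.tauTilde (exp (s • Y)) U

/-- The infinitesimal vector field of `Y` on `𝔤₊^⊥`: `Ỹ(U) = d/ds|₀ τ̃(exp sY) U`. -/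
def infGen (Y : LieAlg Em Gm) (U : D.gpPerp) : LieAlg E G := deriv (D.orbitCurve Y U) 0

/-- The tangent space at `U` of the orbit of `U`. -/
def tangent (U : D.gpPerp) : Submodule ℝ (LieAlg E G) :=
  Submodule.span ℝ (Set.range fun Y : LieAlg Em Gm => D.infGen Y U)

/-- `Ỹ(U)` as a tangent vector of the orbit. -/
def tangentGen (Y : LieAlg Em Gm) (U : D.gpPerp) : D.tangent U :=
  ⟨D.infGen Y U, Submodule.subset_span ⟨Y, rfl⟩⟩

/-- The defining property of the orbit symplectic form at `U`: `Ω_U(Ỹ, Z̃) = ⟨U, [Y, Z]⟩`. As the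
vectors `Ỹ(U)` span the tangent space, at most one bilinear form has it. -/
def IsOrbitForm (U : D.gpPerp) (Ω : LinearMap.BilinForm ℝ (D.tangent U)) : Prop :=
  ∀ Y Z : LieAlg Em Gm,
    Ω (D.tangentGen Y U) (D.tangentGen Z U) = D.form U ⁅D.dIncl Y, D.dIncl Z⁆

/-- The orbit symplectic form at `U`. -/
def orbitForm (U : D.gpPerp) : LinearMap.BilinForm ℝ (D.tangent U) :=
  Classical.epsilon (D.IsOrbitForm U)

/-- `X` is the value at `U` of the Hamiltonian vector field of the restriction `H` of `f` to the
orbit of `U`: `dH_U(v) = Ω_U(v, X)` for every tangent vector `v = Ỹ(U)` of the orbit, where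
`dH_U(Ỹ(U))` is the derivative of `H` along the curve `s ↦ τ̃(exp sY) U`. -/
def IsHamiltonianVector (f : LieAlg E G → ℝ) (U : D.gpPerp) (X : D.tangent U) : Prop :=
  ∀ Y : LieAlg Em Gm,
    deriv (fun s : ℝ => f (D.orbitCurve Y U s)) 0 = D.orbitForm U (D.tangentGen Y U) X

/-- The Hamiltonian vector field of the restriction of `f` to the orbit. -/
def hamiltonianField (f : LieAlg E G → ℝ) (U : D.gpPerp) : D.tangent U :=
  Classical.epsilon (D.IsHamiltonianVector f U)

/-- The Poisson bracket `{H₁, H₂} = Ω(X_{H₁}, X_{H₂})` of the restrictions of two functions to the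
orbit. -/
def poissonBracket (f₁ f₂ : LieAlg E G → ℝ) (U : D.gpPerp) : ℝ :=
  D.orbitForm U (D.hamiltonianField f₁ U) (D.hamiltonianField f₂ U)

end Splitting

end Transadjoint

end

/-!
The vectors `Ỹ(U)` satisfy `⟨Ỹ(U), Z⟩ = -⟨U, [Y, Z]⟩` for `Z ∈ 𝔤₋`, and pairing with `𝔤₋` separates
the points of `𝔤₊^⊥`. Hence the orbit form is well defined and nondegenerate, and `dH_U(Ỹ(U))` is
the pairing of `Ỹ(U)` with `∇f₋(U)`, which gives `X_H(U)`. Differentiating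
`f (τ(g) U) = f(U)` in `g` gives `adᵗ_{∇f(U)} U = 0`, so that the terms with `∇f₊` and `∇f₋` cancel.

For the factorization `exp (s ∇f(U₀)) = g₊(s) g₋(s)`, the one-parameter group
`τ(exp (s ∇f(U₀)))` fixes `U₀`, so `τ(g₊(-s)⁻¹) U₀ = τ̃(g₋(-s)) U₀` stays in the orbit.
Comparing velocities in `g₋(-s) = g₊(-s)⁻¹ exp (-s ∇f(U₀))` shows that the logarithmic
derivative of `g₊(-s)⁻¹` is `∇f₊` at the moving point. Uniqueness holds because the vector
field is of class `C¹`.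

The rules `d/dt τ(γ(t)) = -adᵗ` rest on `d/dt Ad(γ(t)) Y = [γ'(0), Y]`, which is computed in a chart
at the identity from the bracket of left invariant vector fields.
-/

noncomputable section

namespace Transadjoint

section Calculus

variable {E : Type*} [NormedAddCommGroup E] [NormedSpace ℝ E]

/-- The germ at `(e, e)` of a `C²` multiplication with unit `e`, such as the multiplication of a
Lie group read in a chart at the identity. -/
structure IsLocalProduct (m : E × E → E) (e : E) : Prop where
  contDiffAt : ContDiffAt ℝ 2 m (e, e)
  mul_unit : ∀ᶠ x in 𝓝 e, m (x, e) = x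
  unit_mul : ∀ᶠ y in 𝓝 e, m (e, y) = y

/-- The left invariant vector field, with value `Y` at the unit `e`, of the local multiplication
`m`. -/
def leftInvariantField (m : E × E → E) (e Y x : E) : E := fderiv ℝ m (x, e) (0, Y)

namespace IsLocalProduct

variable {m : E × E → E} {e : E}

theorem eventually_differentiableAt (hm : IsLocalProduct m e) :
    ∀ᶠ p in 𝓝 (e, e), DifferentiableAt ℝ m p := by
  filter_upwards [hm.contDiffAt.eventually (by simp)] with p hp
    using hp.differentiableAt (by simp)

theorem fderiv_unit (hm : IsLocalProduct m e) (X Y : E) :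
    fderiv ℝ m (e, e) (X, Y) = X + Y := by
  have hd : HasFDerivAt m (fderiv ℝ m (e, e)) (e, e) :=
    hm.eventually_differentiableAt.self_of_nhds.hasFDerivAt
  have hl : HasFDerivAt (fun x => m (x, e)) _ e :=
    HasFDerivAt.comp (g := m) e hd (hasFDerivAt_prodMk_left e e)
  have hr : HasFDerivAt (fun y => m (e, y)) _ e :=
    HasFDerivAt.comp (g := m) e hd (hasFDerivAt_prodMk_right e e)
  have hX : fderiv ℝ m (e, e) (X, 0) = X := DFunLike.congr_fun
    (hl.unique ((hasFDerivAt_id e).congr_of_eventuallyEq hm.mul_unit)) X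
  have hY : fderiv ℝ m (e, e) (0, Y) = Y := DFunLike.congr_fun
    (hr.unique ((hasFDerivAt_id e).congr_of_eventuallyEq hm.unit_mul)) Y
  have hXY : ((X, Y) : E × E) = (X, 0) + (0, Y) := by simp
  rw [hXY, map_add, hX, hY]

theorem leftInvariantField_unit (hm : IsLocalProduct m e) (Y : E) :
    leftInvariantField m e Y e = Y := by
  rw [leftInvariantField, hm.fderiv_unit, zero_add]

theorem hasFDerivAt_fderiv (hm : IsLocalProduct m e) :
    HasFDerivAt (fderiv ℝ m) (fderiv ℝ (fderiv ℝ m) (e, e)) (e, e) :=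
  ((hm.contDiffAt.fderiv_right (m := 1) (by norm_num)).differentiableAt
    (by norm_num)).hasFDerivAt

theorem hasFDerivAt_leftInvariantField (hm : IsLocalProduct m e) (Y : E) :
    HasFDerivAt (leftInvariantField m e Y)
      (((fderiv ℝ (fderiv ℝ m) (e, e)).comp (.inl ℝ E E)).flip (0, Y)) e := by
  have h : HasFDerivAt (fun x => fderiv ℝ m (x, e)) _ e :=
    HasFDerivAt.comp (g := fderiv ℝ m) e hm.hasFDerivAt_fderiv (hasFDerivAt_prodMk_left e e)
  exact (h.clm_apply (hasFDerivAt_const ((0 : E), Y) e)).congr_fderiv (by simp)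

theorem lieBracket_leftInvariantField (hm : IsLocalProduct m e) (X Y : E) :
    VectorField.lieBracket ℝ (leftInvariantField m e X) (leftInvariantField m e Y) e =
      fderiv ℝ (fderiv ℝ m) (e, e) (X, 0) (0, Y) -
        fderiv ℝ (fderiv ℝ m) (e, e) (Y, 0) (0, X) := by
  rw [VectorField.lieBracket, hm.leftInvariantField_unit, hm.leftInvariantField_unit,
    (hm.hasFDerivAt_leftInvariantField X).fderiv, (hm.hasFDerivAt_leftInvariantField Y).fderiv]
  rfl

end IsLocalProduct

theorem hasDerivAt_of_hasDerivAt_clm_apply [CompleteSpace E] {R : ℝ → E →L[ℝ] E}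
    {R' : E →L[ℝ] E} {a : ℝ → E} {b' : E} {t : ℝ} (u : (E →L[ℝ] E)ˣ) (hu : R t = u)
    (hR : HasDerivAt R R' t) (hb : HasDerivAt (fun s => R s (a s)) b' t) :
    HasDerivAt a ((u⁻¹ : (E →L[ℝ] E)ˣ).1 (b' - R' (a t))) t := by
  have hinv : HasDerivAt (fun s => Ring.inverse (R s))
      (-((u⁻¹ : (E →L[ℝ] E)ˣ).1 * R' * (u⁻¹ : (E →L[ℝ] E)ˣ).1)) t := by
    have h : HasFDerivAt Ring.inverse _ (R t) := hu ▸ hasFDerivAt_ringInverse (𝕜 := ℝ) u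
    exact h.comp_hasDerivAt t hR
  have hunit : ∀ᶠ s in 𝓝 t, IsUnit (R s) :=
    hR.continuousAt (Units.isOpen.mem_nhds (hu ▸ u.isUnit))
  have hinv_apply : ∀ v, (u⁻¹ : (E →L[ℝ] E)ˣ).1 (u.1 v) = v :=
    DFunLike.congr_fun u.inv_mul
  convert (hinv.clm_apply hb).congr_of_eventuallyEq ?_ using 1
  · simp [hu, hinv_apply, sub_eq_neg_add]
  · filter_upwards [hunit] with s hs
    exact (DFunLike.congr_fun (Ring.inverse_mul_cancel _ hs) (a s)).symm

/-- Differentiating `a(s) · x(s) = x(s) · Y` at the unit: the two mixed second derivatives of the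
multiplication enter with opposite signs and make up the bracket. -/
theorem IsLocalProduct.hasDerivAt_of_fderiv_eq [CompleteSpace E] {m : E × E → E} {e : E}
    (hm : IsLocalProduct m e) {x a : ℝ → E} {X Y : E} {t : ℝ} (hxt : x t = e)
    (hx : HasDerivAt x X t)
    (ha : ∀ᶠ s in 𝓝 t, fderiv ℝ m (e, x s) (a s, 0) = leftInvariantField m e Y (x s)) :
    HasDerivAt a
      (VectorField.lieBracket ℝ (leftInvariantField m e X) (leftInvariantField m e Y) e) t := by
  set M := fderiv ℝ (fderiv ℝ m) (e, e)
  have hat : a t = Y := by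
    simpa [hxt, hm.fderiv_unit, hm.leftInvariantField_unit] using ha.self_of_nhds
  have hR : HasDerivAt (fun s => (fderiv ℝ m (e, x s)).comp (.inl ℝ E E))
      ((M (0, X)).comp (.inl ℝ E E)) t := by
    have h : HasDerivAt (fun s => fderiv ℝ m (e, x s)) (M (0, X)) t :=
      hm.hasFDerivAt_fderiv.comp_hasDerivAt_of_eq t ((hasDerivAt_const t e).prodMk hx) (by rw [hxt])
    simpa using h.clm_comp (hasDerivAt_const t (ContinuousLinearMap.inl ℝ E E))
  have hRt : (fderiv ℝ m (e, x t)).comp (.inl ℝ E E) = (1 : (E →L[ℝ] E)ˣ) := by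
    ext v
    simp [hxt, hm.fderiv_unit]
  have hb : HasDerivAt (fun s => ((fderiv ℝ m (e, x s)).comp (.inl ℝ E E)) (a s))
      (M (X, 0) (0, Y)) t :=
    ((hm.hasFDerivAt_leftInvariantField Y).comp_hasDerivAt_of_eq t hx
      hxt.symm).congr_of_eventuallyEq ha
  have hsymm : M (0, X) (Y, 0) = M (Y, 0) (0, X) :=
    (hm.contDiffAt.isSymmSndFDerivAt (by simp)) (0, X) (Y, 0)
  convert hasDerivAt_of_hasDerivAt_clm_apply 1 hRt hR hb using 1
  simp [hm.lieBracket_leftInvariantField, hat, hsymm, M]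

theorem eqOn_Ioo_of_hasDerivAt_of_contDiff [CompleteSpace E] {F : E → E} (hF : ContDiff ℝ 1 F)
    {u v : ℝ → E} {a b t₀ : ℝ} (ht₀ : t₀ ∈ Set.Ioo a b)
    (hu : ∀ s ∈ Set.Ioo a b, HasDerivAt u (F (u s)) s)
    (hv : ∀ s ∈ Set.Ioo a b, HasDerivAt v (F (v s)) s) (h : u t₀ = v t₀) :
    Set.EqOn u v (Set.Ioo a b) := by
  have isMIntegralCurveOn : ∀ w : ℝ → E, (∀ s ∈ Set.Ioo a b, HasDerivAt w (F (w s)) s) →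
      IsMIntegralCurveOn (I := 𝓘(ℝ, E)) w F (Set.Ioo a b) := fun w hw s hs =>
    hasMFDerivWithinAt_iff_hasFDerivWithinAt.2 (hw s hs).hasFDerivAt.hasFDerivWithinAt
  exact isMIntegralCurveOn_Ioo_eqOn_of_contMDiff_boundaryless (I := 𝓘(ℝ, E)) (v := F) ht₀
    ((contMDiff_vectorSpace_iff_contDiff (V := F)).2 hF)
    (isMIntegralCurveOn u hu) (isMIntegralCurveOn v hv) h

end Calculus

section MFDeriv

variable {E : Type*} [NormedAddCommGroup E] [NormedSpace ℝ E]
  {M : Type*} [TopologicalSpace M] [ChartedSpace E M]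
  {F : Type*} [NormedAddCommGroup F] [NormedSpace ℝ F]
  {N : Type*} [TopologicalSpace N] [ChartedSpace F N]

theorem mfderiv_apply_eq_fderiv {f : M → N} {x : M}
    (h : MDifferentiableAt 𝓘(ℝ, E) 𝓘(ℝ, F) f x) (v : E) :
    (mfderiv 𝓘(ℝ, E) 𝓘(ℝ, F) f x : E →L[ℝ] F) v =
      fderiv ℝ (writtenInExtChartAt 𝓘(ℝ, E) 𝓘(ℝ, F) x f) (extChartAt 𝓘(ℝ, E) x x) v := by
  rw [← fderivWithin_univ, ← Set.range_id, ← modelWithCornersSelf_coe ℝ E]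
  exact DFunLike.congr_fun h.mfderiv v

end MFDeriv

section ChartAtOne

variable {E : Type*} [NormedAddCommGroup E] [NormedSpace ℝ E]
  {G : Type*} [TopologicalSpace G] [ChartedSpace E G] [Group G]

variable (E G) in
/-- The preferred chart at the identity. -/
abbrev chartOne : PartialEquiv G E := extChartAt 𝓘(ℝ, E) (1 : G)

variable (E G) in
/-- The multiplication of `G`, read in the chart at the identity. -/
def chartMul (p : E × E) : E :=
  chartOne E G ((chartOne E G).symm p.1 * (chartOne E G).symm p.2)

variable (E G) in
theorem chartOne_symm_one : (chartOne E G).symm (chartOne E G 1) = 1 := extChartAt_to_inv 1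

theorem chartMul_chartOne {g h : G} (hg : g ∈ (chartOne E G).source)
    (hh : h ∈ (chartOne E G).source) :
    chartMul E G (chartOne E G g, chartOne E G h) = chartOne E G (g * h) := by
  simp only [chartMul, (chartOne E G).left_inv hg, (chartOne E G).left_inv hh]

theorem eventually_mem_chartOne_source {γ : ℝ → G} {t₀ : ℝ} (hγ : ContinuousAt γ t₀)
    (h : γ t₀ ∈ (chartOne E G).source) : ∀ᶠ t in 𝓝 t₀, γ t ∈ (chartOne E G).source :=
  hγ.preimage_mem_nhds ((isOpen_extChartAt_source (I := 𝓘(ℝ, E)) (1 : G)).mem_nhds h)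

theorem hasDerivAt_chartOne_mul {γ δ : ℝ → G} {v w : E} {t₀ : ℝ}
    (hγ : ContinuousAt γ t₀) (hγs : γ t₀ ∈ (chartOne E G).source)
    (hv : HasDerivAt (fun t => chartOne E G (γ t)) v t₀)
    (hδ : ContinuousAt δ t₀) (hδs : δ t₀ ∈ (chartOne E G).source)
    (hw : HasDerivAt (fun t => chartOne E G (δ t)) w t₀)
    (hm : DifferentiableAt ℝ (chartMul E G) (chartOne E G (γ t₀), chartOne E G (δ t₀))) :
    HasDerivAt (fun t => chartOne E G (γ t * δ t))
      (fderiv ℝ (chartMul E G) (chartOne E G (γ t₀), chartOne E G (δ t₀)) (v, w)) t₀ := by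
  refine (HasFDerivAt.comp_hasDerivAt t₀ hm.hasFDerivAt (hv.prodMk hw)).congr_of_eventuallyEq ?_
  filter_upwards [eventually_mem_chartOne_source hγ hγs, eventually_mem_chartOne_source hδ hδs]
    with t ht ht' using (chartMul_chartOne ht ht').symm

variable [LieGroup 𝓘(ℝ, E) ∞ G]

variable (E G) in
theorem contMDiffAt_chartOne_symm :
    ContMDiffAt 𝓘(ℝ, E) 𝓘(ℝ, E) ∞ (chartOne E G).symm (chartOne E G 1) :=
  (contMDiffOn_extChartAt_symm (1 : G)).contMDiffAt (extChartAt_target_mem_nhds 1)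

variable (E G) in
theorem contDiffAt_chartMul :
    ContDiffAt ℝ ∞ (chartMul E G) (chartOne E G 1, chartOne E G 1) := by
  rw [← contMDiffAt_iff_contDiffAt]
  have hsymm := contMDiffAt_chartOne_symm E G
  have hfst : ContMDiffAt 𝓘(ℝ, E × E) 𝓘(ℝ, E) ∞ (fun p : E × E => (chartOne E G).symm p.1)
      (chartOne E G 1, chartOne E G 1) :=
    ContMDiffAt.comp (g := (chartOne E G).symm) _ hsymm contDiff_fst.contMDiff.contMDiffAt
  have hsnd : ContMDiffAt 𝓘(ℝ, E × E) 𝓘(ℝ, E) ∞ (fun p : E × E => (chartOne E G).symm p.2)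
      (chartOne E G 1, chartOne E G 1) :=
    ContMDiffAt.comp (g := (chartOne E G).symm) _ hsymm contDiff_snd.contMDiff.contMDiffAt
  refine ContMDiffAt.comp (g := chartOne E G) _ ?_ (hfst.mul hsnd)
  simp only [chartOne_symm_one, mul_one]
  exact contMDiffAt_extChartAt

variable (E G) in
theorem isLocalProduct_chartMul : IsLocalProduct (chartMul E G) (chartOne E G 1) where
  contDiffAt := (contDiffAt_chartMul E G).of_le
    (WithTop.coe_le_coe.2 le_top : ((2 : ℕ∞) : WithTop ℕ∞) ≤ ∞)
  mul_unit := by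
    filter_upwards [extChartAt_target_mem_nhds (I := 𝓘(ℝ, E)) (1 : G)] with x hx
    simp only [chartMul, chartOne_symm_one, mul_one, (chartOne E G).right_inv hx]
  unit_mul := by
    filter_upwards [extChartAt_target_mem_nhds (I := 𝓘(ℝ, E)) (1 : G)] with x hx
    simp only [chartMul, chartOne_symm_one, one_mul, (chartOne E G).right_inv hx]

theorem mfderiv_chartOne_mulInvariantVectorField {x : E} (hx : x ∈ (chartOne E G).target)
    (hd : DifferentiableAt ℝ (chartMul E G) (x, chartOne E G 1)) (Y : LieAlg E G) :
    (mfderiv 𝓘(ℝ, E) 𝓘(ℝ, E) (chartOne E G) ((chartOne E G).symm x) : E →L[ℝ] E)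
        (mulInvariantVectorField (I := 𝓘(ℝ, E)) Y ((chartOne E G).symm x)) =
      leftInvariantField (chartMul E G) (chartOne E G 1) Y x := by
  set g : G := (chartOne E G).symm x
  have hmul : MDifferentiableAt 𝓘(ℝ, E) 𝓘(ℝ, E) (fun h : G => g * h) 1 :=
    (contMDiff_mul_left (I := 𝓘(ℝ, E)) (n := ∞)).mdifferentiable (by simp) 1
  have hchart : MDifferentiableAt 𝓘(ℝ, E) 𝓘(ℝ, E) (chartOne E G) g :=
    mdifferentiableAt_extChartAt <| by
      rw [← extChartAt_source 𝓘(ℝ, E)]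
      exact (chartOne E G).map_target hx
  have hchart' : HasMFDerivAt 𝓘(ℝ, E) 𝓘(ℝ, E) (chartOne E G) (g * 1)
      (mfderiv 𝓘(ℝ, E) 𝓘(ℝ, E) (chartOne E G) g : E →L[ℝ] E) := by
    rw [mul_one]
    exact hchart.hasMFDerivAt
  have hcomp := (hchart'.comp (1 : G) hmul.hasMFDerivAt).mfderiv
  have hwritten : writtenInExtChartAt 𝓘(ℝ, E) 𝓘(ℝ, E) (1 : G)
      (chartOne E G ∘ fun h : G => g * h) = fun y => chartMul E G (x, y) := by
    funext y
    simp only [writtenInExtChartAt, Function.comp_apply, chartMul, extChartAt_model_space_eq_id]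
    rfl
  have hright : HasFDerivAt (fun y => chartMul E G (x, y)) _ (chartOne E G 1) :=
    HasFDerivAt.comp _ (g := chartMul E G) hd.hasFDerivAt (hasFDerivAt_prodMk_right _ _)
  have h := mfderiv_apply_eq_fderiv (hchart'.mdifferentiableAt.comp (1 : G) hmul) (Y : E)
  rw [hwritten, hright.fderiv] at h
  exact (DFunLike.congr_fun hcomp Y).symm.trans h

theorem mpullbackWithin_chartOne_symm_mulInvariantVectorField (Y : LieAlg E G) :
    ∀ᶠ x in 𝓝 (chartOne E G 1),
      (VectorField.mpullbackWithin 𝓘(ℝ, E) 𝓘(ℝ, E) (chartOne E G).symm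
        (mulInvariantVectorField (I := 𝓘(ℝ, E)) Y) (Set.range 𝓘(ℝ, E)) x : E) =
      leftInvariantField (chartMul E G) (chartOne E G 1) Y x := by
  have htendsto : Filter.Tendsto (fun x : E => (x, chartOne E G 1)) (𝓝 (chartOne E G 1))
      (𝓝 (chartOne E G 1, chartOne E G 1)) :=
    continuousAt_id.prodMk continuousAt_const
  filter_upwards [htendsto.eventually (isLocalProduct_chartMul E G).eventually_differentiableAt,
    extChartAt_target_mem_nhds (I := 𝓘(ℝ, E)) (1 : G)] with x hd hx
  have : IsManifold 𝓘(ℝ, E) 1 G := inferInstance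
  have hinv : (mfderivWithin 𝓘(ℝ, E) 𝓘(ℝ, E) (chartOne E G).symm (Set.range 𝓘(ℝ, E)) x).inverse
      = mfderiv 𝓘(ℝ, E) 𝓘(ℝ, E) (chartOne E G) ((chartOne E G).symm x) :=
    ContinuousLinearMap.inverse_eq
      (mfderivWithin_extChartAt_symm_comp_mfderiv_extChartAt hx)
      (mfderiv_extChartAt_comp_mfderivWithin_extChartAt_symm hx)
  rw [VectorField.mpullbackWithin_apply, hinv]
  exact mfderiv_chartOne_mulInvariantVectorField hx hd Y

theorem bracket_eq_lieBracket_leftInvariantField (X Y : LieAlg E G) :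
    (⁅X, Y⁆ : LieAlg E G) = VectorField.lieBracket ℝ
      (leftInvariantField (chartMul E G) (chartOne E G 1) X)
      (leftInvariantField (chartMul E G) (chartOne E G 1) Y) (chartOne E G 1) := by
  have : IsManifold 𝓘(ℝ, E) 1 G := inferInstance
  have hid : (mfderiv 𝓘(ℝ, E) 𝓘(ℝ, E) (chartOne E G) (1 : G) : E →L[ℝ] E)
      = ContinuousLinearMap.id ℝ E := mfderiv_extChartAt_self
  have hinv : ∀ v : E, (mfderiv 𝓘(ℝ, E) 𝓘(ℝ, E) (chartOne E G) (1 : G) : E →L[ℝ] E).inverse v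
      = v := fun v => (congrArg (fun A : E →L[ℝ] E => A.inverse v) hid).trans
    (by simp only [ContinuousLinearMap.inverse_id, ContinuousLinearMap.id_apply])
  have hcongr : ∀ (V W V' W' : E → E) (s : Set E), s = Set.univ → V =ᶠ[𝓝 (chartOne E G 1)] V' →
      W =ᶠ[𝓝 (chartOne E G 1)] W' → VectorField.lieBracketWithin ℝ V W s (chartOne E G 1) =
        VectorField.lieBracket ℝ V' W' (chartOne E G 1) := by
    rintro V W V' W' _ rfl hV hW
    rw [VectorField.lieBracketWithin_univ, hV.lieBracket_vectorField_eq hW]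
  exact (hinv _).trans (hcongr _ _ _ _ _ (by simp)
    (mpullbackWithin_chartOne_symm_mulInvariantVectorField X)
    (mpullbackWithin_chartOne_symm_mulInvariantVectorField Y))

end ChartAtOne

section VelocityAtOne

variable {E : Type*} [NormedAddCommGroup E] [NormedSpace ℝ E]
  {G : Type*} [TopologicalSpace G] [ChartedSpace E G] [Group G]

local instance : T2Space (LieAlg E G) := inferInstanceAs (T2Space E)

/-- The curve `γ` passes through the identity at time `t₀`, with velocity `ξ`. -/
structure HasVelocityAtOne (γ : ℝ → G) (ξ : LieAlg E G) (t₀ : ℝ) : Prop where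
  eq_one : γ t₀ = 1
  continuousAt : ContinuousAt γ t₀
  hasDerivAt : HasDerivAt (fun t => chartOne E G (γ t)) (ξ : E) t₀

theorem hasVelocityAtOne_one (t₀ : ℝ) : HasVelocityAtOne (fun _ => (1 : G)) (0 : LieAlg E G) t₀ :=
  ⟨rfl, continuousAt_const, hasDerivAt_const _ _⟩

theorem hasVelocityAtOne_iff {γ : ℝ → G} {ξ : LieAlg E G} {t₀ : ℝ} :
    HasVelocityAtOne γ ξ t₀ ↔ γ t₀ = 1 ∧
      HasMFDerivAt 𝓘(ℝ, ℝ) 𝓘(ℝ, E) γ t₀ (ContinuousLinearMap.toSpanSingleton ℝ (ξ : E)) := by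
  have hderiv (h : γ t₀ = 1) (v : E) : HasDerivAt (fun t => chartOne E G (γ t)) v t₀ ↔
      HasFDerivWithinAt (writtenInExtChartAt 𝓘(ℝ, ℝ) 𝓘(ℝ, E) t₀ γ)
        (ContinuousLinearMap.toSpanSingleton ℝ v) (Set.range 𝓘(ℝ, ℝ)) t₀ := by
    have hwritten : writtenInExtChartAt 𝓘(ℝ, ℝ) 𝓘(ℝ, E) t₀ γ = fun t => chartOne E G (γ t) := by
      funext t
      simp only [writtenInExtChartAt, Function.comp_apply, h, extChartAt_model_space_eq_id]
      rfl
    rw [hwritten, modelWithCornersSelf_coe, Set.range_id, hasFDerivWithinAt_univ,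
      hasDerivAt_iff_hasFDerivAt]
  exact ⟨fun h => ⟨h.1, h.2, (hderiv h.1 ξ).1 h.3⟩, fun h => ⟨h.1, h.2.1, (hderiv h.1 ξ).2 h.2.2⟩⟩

theorem exists_hasVelocityAtOne_of_mdifferentiableAt {γ : ℝ → G} {t₀ : ℝ} (h1 : γ t₀ = 1)
    (h : MDifferentiableAt 𝓘(ℝ, ℝ) 𝓘(ℝ, E) γ t₀) :
    ∃ ξ : LieAlg E G, HasVelocityAtOne γ ξ t₀ := by
  have hspan : ContinuousLinearMap.toSpanSingleton ℝ
      ((mfderiv 𝓘(ℝ, ℝ) 𝓘(ℝ, E) γ t₀ : ℝ →L[ℝ] E) 1) = mfderiv 𝓘(ℝ, ℝ) 𝓘(ℝ, E) γ t₀ :=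
    ContinuousLinearMap.ext_ring (one_smul ℝ _)
  refine ⟨(mfderiv 𝓘(ℝ, ℝ) 𝓘(ℝ, E) γ t₀ : ℝ →L[ℝ] E) 1, hasVelocityAtOne_iff.2 ⟨h1, ?_⟩⟩
  rw [hspan]
  exact h.hasMFDerivAt

theorem exists_hasVelocityAtOne [LieGroup 𝓘(ℝ, E) ∞ G] (ξ : LieAlg E G) (t₀ : ℝ) :
    ∃ γ : ℝ → G, HasVelocityAtOne γ ξ t₀ := by
  let v : E := ξ
  let line : ℝ → E := fun t => chartOne E G 1 + (t - t₀) • v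
  have hline : HasDerivAt line v t₀ := by
    simpa [line] using ((hasDerivAt_id t₀).sub_const t₀).smul_const v
  have hline₀ : line t₀ = chartOne E G 1 := by simp [line]
  have htarget : ∀ᶠ t in 𝓝 t₀, line t ∈ (chartOne E G).target :=
    hline.continuousAt (by rw [hline₀]; exact extChartAt_target_mem_nhds 1)
  refine ⟨fun t => (chartOne E G).symm (line t), by rw [hline₀, chartOne_symm_one],
    ContinuousAt.comp_of_eq (contMDiffAt_chartOne_symm E G).continuousAt hline.continuousAt hline₀,
    hline.congr_of_eventuallyEq ?_⟩
  filter_upwards [htarget] with t ht using (chartOne E G).right_inv ht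

namespace HasVelocityAtOne

variable {γ δ : ℝ → G} {ξ η : LieAlg E G} {t₀ : ℝ}

theorem unique (h : HasVelocityAtOne γ ξ t₀) (h' : HasVelocityAtOne γ η t₀) : ξ = η :=
  h.hasDerivAt.unique h'.hasDerivAt

theorem comp_affine (h : HasVelocityAtOne γ ξ t₀) (a b : ℝ) {s₀ : ℝ} (hs : a * s₀ + b = t₀) :
    HasVelocityAtOne (fun s => γ (a * s + b)) (a • ξ) s₀ := by
  subst hs
  have hd : HasDerivAt (fun s : ℝ => a * s + b) a s₀ := by
    simpa using ((hasDerivAt_id s₀).const_mul a).add_const b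
  exact ⟨h.eq_one, ContinuousAt.comp (g := γ) h.continuousAt hd.continuousAt,
    HasDerivAt.scomp (h := fun s : ℝ => a * s + b) s₀ h.hasDerivAt hd⟩

theorem mem_source (h : HasVelocityAtOne γ ξ t₀) : γ t₀ ∈ (chartOne E G).source := by
  rw [h.eq_one]
  exact mem_extChartAt_source 1

section Map

variable {F : Type*} [NormedAddCommGroup F] [NormedSpace ℝ F]
  {K : Type*} [TopologicalSpace K] [ChartedSpace F K] [Group K] {κ : ℝ → K} {ζ : LieAlg F K}

theorem comp_mfderiv (h : HasVelocityAtOne κ ζ t₀) {f : K → G}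
    (hf : MDifferentiableAt 𝓘(ℝ, F) 𝓘(ℝ, E) f 1) (hf1 : f 1 = 1) :
    HasVelocityAtOne (fun t => f (κ t))
      ((mfderiv 𝓘(ℝ, F) 𝓘(ℝ, E) f 1 : F →L[ℝ] E) ζ : E) t₀ := by
  obtain ⟨hκ, hκ'⟩ := hasVelocityAtOne_iff.1 h
  have hf' : HasMFDerivAt 𝓘(ℝ, F) 𝓘(ℝ, E) f (κ t₀)
      (mfderiv 𝓘(ℝ, F) 𝓘(ℝ, E) f 1 : F →L[ℝ] E) := by
    rw [hκ]
    exact hf.hasMFDerivAt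
  refine hasVelocityAtOne_iff.2 ⟨by rw [hκ, hf1], ?_⟩
  have hspan : ContinuousLinearMap.toSpanSingleton ℝ
      ((mfderiv 𝓘(ℝ, F) 𝓘(ℝ, E) f 1 : F →L[ℝ] E) (ζ : F)) =
      (mfderiv 𝓘(ℝ, F) 𝓘(ℝ, E) f 1 : F →L[ℝ] E).comp
        (ContinuousLinearMap.toSpanSingleton ℝ (ζ : F)) :=
    ContinuousLinearMap.ext_ring (by simp)
  exact Eq.mpr (congrArg (fun A : ℝ →L[ℝ] E =>
    HasMFDerivAt 𝓘(ℝ, ℝ) 𝓘(ℝ, E) (fun t => f (κ t)) t₀ A) hspan) (hf'.comp t₀ hκ')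

theorem map (h : HasVelocityAtOne κ ζ t₀) (ι : K →* G) (hι : ContMDiff 𝓘(ℝ, F) 𝓘(ℝ, E) ∞ ι) :
    HasVelocityAtOne (fun t => ι (κ t)) (differential (E := E) ι ζ) t₀ :=
  h.comp_mfderiv (hι.mdifferentiable (by simp) 1) (map_one ι)

end Map

variable [LieGroup 𝓘(ℝ, E) ∞ G]

theorem conj (h : HasVelocityAtOne γ ξ t₀) (g : G) :
    HasVelocityAtOne (fun t => g * γ t * g⁻¹) (Ad g ξ) t₀ := by
  have hconj : ContMDiff 𝓘(ℝ, E) 𝓘(ℝ, E) ∞ (fun h : G => g * h * g⁻¹) :=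
    (contMDiff_const.mul contMDiff_id).mul contMDiff_const
  exact h.comp_mfderiv (hconj.mdifferentiable (by simp) 1) (by group)

theorem mul (h : HasVelocityAtOne γ ξ t₀) (h' : HasVelocityAtOne δ η t₀) :
    HasVelocityAtOne (fun t => γ t * δ t) (ξ + η) t₀ := by
  have : IsTopologicalGroup G := topologicalGroup_of_lieGroup 𝓘(ℝ, E) ∞
  have hm := isLocalProduct_chartMul E G
  refine ⟨by rw [h.eq_one, h'.eq_one, one_mul], h.continuousAt.mul h'.continuousAt, ?_⟩
  have hd := hasDerivAt_chartOne_mul h.continuousAt h.mem_source h.hasDerivAt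
    h'.continuousAt h'.mem_source h'.hasDerivAt
    (by rw [h.eq_one, h'.eq_one]; exact hm.eventually_differentiableAt.self_of_nhds)
  rw [h.eq_one, h'.eq_one] at hd
  exact hd.congr_deriv (hm.fderiv_unit (ξ : E) (η : E))

theorem inv (h : HasVelocityAtOne γ ξ t₀) : HasVelocityAtOne (fun t => (γ t)⁻¹) (-ξ) t₀ := by
  have hinv : MDifferentiableAt 𝓘(ℝ, E) 𝓘(ℝ, E) (fun g : G => g⁻¹) 1 :=
    (contMDiff_inv 𝓘(ℝ, E) ∞).mdifferentiable (by simp) 1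
  have h' := h.comp_mfderiv hinv inv_one
  have hmul := h.mul h'
  simp only [mul_inv_cancel] at hmul
  rwa [← eq_neg_of_add_eq_zero_right (hmul.unique (hasVelocityAtOne_one t₀))]

end HasVelocityAtOne

section Ad

variable [LieGroup 𝓘(ℝ, E) ∞ G]

theorem Ad_mul (g h : G) (X : LieAlg E G) : Ad (g * h) X = Ad g (Ad h X) := by
  obtain ⟨γ, hγ⟩ := exists_hasVelocityAtOne X 0
  refine (hγ.conj (g * h)).unique ?_
  convert (hγ.conj h).conj g using 2
  group

theorem Ad_one (X : LieAlg E G) : Ad (1 : G) X = X := by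
  obtain ⟨γ, hγ⟩ := exists_hasVelocityAtOne X 0
  exact (hγ.conj 1).unique (by simpa using hγ)

theorem Ad_Ad_inv (g : G) (X : LieAlg E G) : Ad g (Ad g⁻¹ X) = X := by
  rw [← Ad_mul, mul_inv_cancel, Ad_one]

theorem differential_Ad {F : Type*} [NormedAddCommGroup F] [NormedSpace ℝ F]
    {K : Type*} [TopologicalSpace K] [ChartedSpace F K] [Group K] [LieGroup 𝓘(ℝ, F) ∞ K]
    (ι : K →* G) (hι : ContMDiff 𝓘(ℝ, F) 𝓘(ℝ, E) ∞ ι) (k : K) (X : LieAlg F K) :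
    differential (E := E) ι (Ad k X) = Ad (ι k) (differential (E := E) ι X) := by
  obtain ⟨γ, hγ⟩ := exists_hasVelocityAtOne X 0
  refine ((hγ.conj k).map ι hι).unique ?_
  simpa only [map_mul, map_inv] using (hγ.map ι hι).conj (ι k)

/-- Obtained by differentiating `(g * δ t * g⁻¹) * g = g * δ t` along a curve `δ` with
velocity `Y`. -/
theorem eventually_fderiv_chartMul_Ad (Y : LieAlg E G) :
    ∀ᶠ g in 𝓝 (1 : G), fderiv ℝ (chartMul E G) (chartOne E G 1, chartOne E G g) (Ad g Y, 0) =
      leftInvariantField (chartMul E G) (chartOne E G 1) Y (chartOne E G g) := by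
  have hm := (isLocalProduct_chartMul E G).eventually_differentiableAt
  have hφ : Filter.Tendsto (chartOne E G) (𝓝 1) (𝓝 (chartOne E G 1)) :=
    continuousAt_extChartAt (1 : G)
  filter_upwards [(hφ.prodMk_nhds tendsto_const_nhds).eventually hm,
    (tendsto_const_nhds.prodMk_nhds hφ).eventually hm,
    extChartAt_source_mem_nhds (I := 𝓘(ℝ, E)) (1 : G)] with g hl hr hg
  obtain ⟨δ, hδ⟩ := exists_hasVelocityAtOne Y 0
  have hconj := hδ.conj g
  have hright := hasDerivAt_chartOne_mul hconj.continuousAt hconj.mem_source hconj.hasDerivAt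
    (continuousAt_const (y := g)) hg (hasDerivAt_const _ _) (by rwa [hconj.eq_one])
  have hleft := hasDerivAt_chartOne_mul (continuousAt_const (y := g)) hg (hasDerivAt_const _ _)
    hδ.continuousAt hδ.mem_source hδ.hasDerivAt (by rwa [hδ.eq_one])
  simp only [inv_mul_cancel_right, hconj.eq_one] at hright
  simp only [hδ.eq_one] at hleft
  exact hright.unique hleft

theorem HasVelocityAtOne.hasDerivAt_Ad [CompleteSpace E] {γ : ℝ → G} {ξ : LieAlg E G} {t₀ : ℝ}
    (h : HasVelocityAtOne γ ξ t₀) (Y : LieAlg E G) :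
    HasDerivAt (fun t => Ad (γ t) Y) ⁅ξ, Y⁆ t₀ := by
  have hγ : Filter.Tendsto γ (𝓝 t₀) (𝓝 1) := h.eq_one ▸ h.continuousAt
  rw [bracket_eq_lieBracket_leftInvariantField]
  exact (isLocalProduct_chartMul E G).hasDerivAt_of_fderiv_eq (by rw [h.eq_one]) h.hasDerivAt
    (hγ.eventually (eventually_fderiv_chartMul_Ad Y))

end Ad

end VelocityAtOne

section OneParameterSubgroups

variable {E : Type*} [NormedAddCommGroup E] [NormedSpace ℝ E]
  {G : Type*} [TopologicalSpace G] [ChartedSpace E G] [Group G] {X : LieAlg E G} {c d : ℝ → G}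

theorem mulInvariantVectorField_one (X : LieAlg E G) :
    (mulInvariantVectorField (I := 𝓘(ℝ, E)) X (1 : G) : E) = X := by
  have hid : (fun g : G => 1 * g) = id := funext one_mul
  rw [mulInvariantVectorField, hid]
  exact DFunLike.congr_fun (mfderiv_id (I := 𝓘(ℝ, E)) (x := (1 : G))) X

theorem IsOneParam.smul (hc : IsOneParam X c) (a : ℝ) :
    IsOneParam (a • X) (fun t => c (t * a)) := by
  refine ⟨by simpa using hc.1, ?_⟩
  rw [mulInvariantVectorField_smul]
  exact hc.2.comp_mul a

theorem IsOneParam.hasVelocityAtOne (hc : IsOneParam X c) : HasVelocityAtOne c X 0 := by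
  have h1 : (mulInvariantVectorField (I := 𝓘(ℝ, E)) X (c 0) : E) = X := by
    rw [hc.1]
    exact mulInvariantVectorField_one X
  refine hasVelocityAtOne_iff.2 ⟨hc.1, ?_⟩
  rw [← h1]
  exact hc.2 0

variable [LieGroup 𝓘(ℝ, E) ∞ G]

theorem mdifferentiableAt_mul_left (g h : G) :
    MDifferentiableAt 𝓘(ℝ, E) 𝓘(ℝ, E) (fun x : G => g * x) h :=
  (contMDiff_mul_left (I := 𝓘(ℝ, E)) (n := ∞)).mdifferentiable (by simp) h

theorem mfderiv_mul_left_mulInvariantVectorField (X : LieAlg E G) (g h : G) :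
    (mfderiv 𝓘(ℝ, E) 𝓘(ℝ, E) (fun x : G => g * x) h : E →L[ℝ] E)
      (mulInvariantVectorField (I := 𝓘(ℝ, E)) X h : E) =
      mulInvariantVectorField (I := 𝓘(ℝ, E)) X (g * h) := by
  have hg : HasMFDerivAt 𝓘(ℝ, E) 𝓘(ℝ, E) (fun x : G => g * x) (h * 1)
      (mfderiv 𝓘(ℝ, E) 𝓘(ℝ, E) (fun x : G => g * x) h : E →L[ℝ] E) := by
    rw [mul_one]
    exact (mdifferentiableAt_mul_left g h).hasMFDerivAt
  have hcomp := (hg.comp (1 : G) (mdifferentiableAt_mul_left h 1).hasMFDerivAt).mfderiv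
  have hmul : ((fun x : G => g * x) ∘ fun x : G => h * x) = fun x : G => g * h * x :=
    funext fun x => (mul_assoc g h x).symm
  rw [hmul] at hcomp
  exact (DFunLike.congr_fun hcomp X).symm

theorem isMIntegralCurveOn_const_mul {s : Set ℝ}
    (hc : IsMIntegralCurveOn c (mulInvariantVectorField (I := 𝓘(ℝ, E)) X) s) (g : G) :
    IsMIntegralCurveOn (fun t => g * c t) (mulInvariantVectorField (I := 𝓘(ℝ, E)) X) s := by
  intro t ht
  have hcomp :=
    (mdifferentiableAt_mul_left g (c t)).hasMFDerivAt.comp_hasMFDerivWithinAt t (hc t ht)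
  have hvel : (mfderiv 𝓘(ℝ, E) 𝓘(ℝ, E) (fun x : G => g * x) (c t) : E →L[ℝ] E).comp
      ((1 : ℝ →L[ℝ] ℝ).smulRight (mulInvariantVectorField (I := 𝓘(ℝ, E)) X (c t) : E)) =
      (1 : ℝ →L[ℝ] ℝ).smulRight (mulInvariantVectorField (I := 𝓘(ℝ, E)) X (g * c t) : E) := by
    rw [← mfderiv_mul_left_mulInvariantVectorField]
    exact ContinuousLinearMap.ext_ring (by simp)
  exact Eq.mp (congrArg (fun A : ℝ →L[ℝ] E =>
    HasMFDerivWithinAt 𝓘(ℝ, ℝ) 𝓘(ℝ, E) (fun t => g * c t) s t A) hvel) hcomp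

theorem isMIntegralCurve_const_mul
    (hc : IsMIntegralCurve c (mulInvariantVectorField (I := 𝓘(ℝ, E)) X)) (g : G) :
    IsMIntegralCurve (fun t => g * c t) (mulInvariantVectorField (I := 𝓘(ℝ, E)) X) := by
  rw [isMIntegralCurve_iff_isMIntegralCurveOn] at hc ⊢
  exact isMIntegralCurveOn_const_mul hc g

theorem contMDiff_one_mulInvariantVectorField (X : LieAlg E G) :
    ContMDiff 𝓘(ℝ, E) 𝓘(ℝ, E).tangent 1
      (fun g : G => (⟨g, mulInvariantVectorField X g⟩ : TangentBundle 𝓘(ℝ, E) G)) :=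
  (contMDiff_mulInvariantVectorField X).of_le (by simp)

variable [T2Space G]

theorem eq_of_isMIntegralCurve
    (hc : IsMIntegralCurve c (mulInvariantVectorField (I := 𝓘(ℝ, E)) X))
    (hd : IsMIntegralCurve d (mulInvariantVectorField (I := 𝓘(ℝ, E)) X)) (h : c 0 = d 0) :
    c = d :=
  have : IsManifold 𝓘(ℝ, E) 1 G := inferInstance
  isMIntegralCurve_Ioo_eq_of_contMDiff_boundaryless (t₀ := 0)
    (contMDiff_one_mulInvariantVectorField X) hc hd h

theorem IsOneParam.unique (hc : IsOneParam X c) (hd : IsOneParam X d) : c = d :=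
  eq_of_isMIntegralCurve hc.2 hd.2 (hc.1.trans hd.1.symm)

theorem IsOneParam.add (hc : IsOneParam X c) (s t : ℝ) : c (s + t) = c s * c t := by
  have h := eq_of_isMIntegralCurve (hc.2.comp_add s) (isMIntegralCurve_const_mul hc.2 (c s))
    (by simp [hc.1])
  simpa [add_comm] using congrFun h t

theorem IsOneParam.exp_eq (hc : IsOneParam X c) : exp X = c 1 := by
  obtain ⟨d, hd, hd1⟩ := Classical.epsilon_spec
    (p := fun g : G => ∃ c : ℝ → G, IsOneParam X c ∧ c 1 = g) ⟨c 1, c, hc, rfl⟩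
  rw [hc.unique hd]
  exact hd1.symm

variable [CompleteSpace E]

theorem exists_isOneParam (X : LieAlg E G) : ∃ c : ℝ → G, IsOneParam X c := by
  have : IsManifold 𝓘(ℝ, E) 1 G := inferInstance
  have hX := contMDiff_one_mulInvariantVectorField X
  obtain ⟨γ, hγ₀, hγ⟩ := exists_isMIntegralCurveAt_of_contMDiffAt_boundaryless 0
    (hX.contMDiffAt (x := (1 : G)))
  obtain ⟨ε, hε, hγε⟩ := isMIntegralCurveAt_iff'.1 hγ
  rw [Real.ball_eq_Ioo, zero_sub, zero_add] at hγε
  exact exists_isMIntegralCurve_of_isMIntegralCurveOn hX hε (fun g =>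
    ⟨fun t => g * γ t, by simp only [hγ₀, mul_one], isMIntegralCurveOn_const_mul hγε g⟩) 1

theorem isOneParam_exp (X : LieAlg E G) : IsOneParam X (fun s : ℝ => exp (s • X)) := by
  obtain ⟨c, hc⟩ := exists_isOneParam X
  have hexp (s : ℝ) : exp (s • X) = c s := by rw [(hc.smul s).exp_eq, one_mul]
  simpa only [hexp] using hc

theorem exp_zero_smul (X : LieAlg E G) : exp ((0 : ℝ) • X) = 1 := (isOneParam_exp X).1

theorem exp_add_smul (X : LieAlg E G) (s t : ℝ) :
    exp ((s + t) • X) = exp (s • X) * exp (t • X) :=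
  (isOneParam_exp X).add s t

theorem exp_neg_smul (X : LieAlg E G) (s : ℝ) : exp (-s • X) = (exp (s • X))⁻¹ := by
  rw [eq_inv_iff_mul_eq_one, ← exp_add_smul, neg_add_cancel, exp_zero_smul]

end OneParameterSubgroups

section FiniteDimensionalCalculus

variable {V W : Type*} [NormedAddCommGroup V] [NormedSpace ℝ V] [FiniteDimensional ℝ V]
  [NormedAddCommGroup W] [NormedSpace ℝ W] {u : ℝ → V} {u' : V} {t₀ : ℝ} {f : V → W}

theorem hasDerivAt_linearMap_apply (L : V →ₗ[ℝ] W) (hu : HasDerivAt u u' t₀) :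
    HasDerivAt (fun t => L (u t)) (L u') t₀ :=
  HasFDerivAt.comp_hasDerivAt t₀ L.toContinuousLinearMap.hasFDerivAt hu

theorem hasDerivAt_of_bilinForm {B : LinearMap.BilinForm ℝ V} (hB : B.Nondegenerate)
    (h : ∀ z, HasDerivAt (fun t => B (u t) z) (B u' z) t₀) : HasDerivAt u u' t₀ := by
  let b := Module.finBasis ℝ V
  let d := B.dualBasis hB b
  have hexpand (x : V) : ∑ i, B x (b i) • d i = x := by
    conv_rhs => rw [← d.sum_repr x]
    simp only [d, LinearMap.BilinForm.dualBasis_repr_apply]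
  have hsum : HasDerivAt (fun t => ∑ i, B (u t) (b i) • d i) (∑ i, B u' (b i) • d i) t₀ :=
    HasDerivAt.fun_sum fun i _ => (h (b i)).smul_const (d i)
  simpa only [hexpand] using hsum

theorem fderiv_apply_of_comp_linearMap_eq (hf : Differentiable ℝ f) (L : V →ₗ[ℝ] V)
    (hL : ∀ x, f (L x) = f x) (x v : V) : fderiv ℝ f (L x) (L v) = fderiv ℝ f x v := by
  have hcomp : HasFDerivAt (fun x => f (L x)) _ x :=
    (hf (L x)).hasFDerivAt.comp x L.toContinuousLinearMap.hasFDerivAt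
  simp only [hL] at hcomp
  exact DFunLike.congr_fun (hcomp.unique (hf x).hasFDerivAt) v

theorem contDiff_linearMap_fderiv {n : WithTop ℕ∞} {f : V → ℝ} (hf : ContDiff ℝ (n + 1) f)
    (L : Module.Dual ℝ V →ₗ[ℝ] W) :
    ContDiff ℝ n (fun x => L (fderiv ℝ f x : V →ₗ[ℝ] ℝ)) :=
  (L ∘ₗ (LinearMap.toContinuousLinearMap (𝕜 := ℝ) (E := V)
    (F' := ℝ)).symm.toLinearMap).toContinuousLinearMap.contDiff.comp (hf.fderiv_right le_rfl)

theorem contDiff_bilinear_apply {n : WithTop ℕ∞} (T : V →ₗ[ℝ] V →ₗ[ℝ] W) {a b : V → V}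
    (ha : ContDiff ℝ n a) (hb : ContDiff ℝ n b) : ContDiff ℝ n (fun x => T (a x) (b x)) :=
  ((LinearMap.toContinuousLinearMap.toLinearMap ∘ₗ T).toContinuousLinearMap.contDiff.comp
    ha).clm_apply hb

end FiniteDimensionalCalculus

section Form

theorem eq_of_bilinForm_eq {R M : Type*} [CommRing R] [AddCommGroup M] [Module R M]
    {B : LinearMap.BilinForm R M} (hB : B.Nondegenerate) {x y : M} (h : ∀ z, B x z = B y z) :
    x = y :=
  sub_eq_zero.1 (hB.1 _ fun z => by rw [map_sub, LinearMap.sub_apply, h, sub_self])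

variable {E : Type*} [NormedAddCommGroup E] [NormedSpace ℝ E]
  {G : Type*} [TopologicalSpace G] [ChartedSpace E G] [Group G]
  {B : LinearMap.BilinForm ℝ (LieAlg E G)}

theorem IsSmooth.hasDerivAt_comp {f : LieAlg E G → ℝ} (hf : IsSmooth f) {u : ℝ → LieAlg E G}
    {u' : LieAlg E G} {t₀ : ℝ} (hu : HasDerivAt u u' t₀) :
    HasDerivAt (fun t => f (u t)) (fderiv ℝ f (u t₀) u') t₀ :=
  HasFDerivAt.comp_hasDerivAt (F := E) t₀ (ContDiff.differentiable hf (by simp) _).hasFDerivAt hu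

variable [FiniteDimensional ℝ E]

theorem form_tau (hB : B.Nondegenerate) (g : G) (X Y : LieAlg E G) :
    B (tau hB g X) Y = B X (Ad g⁻¹ Y) :=
  LinearMap.BilinForm.isAdjointPairLeftAdjointOfNondegenerate B hB _ X Y

theorem form_grad (hB : B.Nondegenerate) (f : LieAlg E G → ℝ) (U Y : LieAlg E G) :
    B (grad hB f U) Y = fderiv ℝ f U Y := by
  rw [grad, LinearMap.BilinForm.apply_toDual_symm_apply]
  rfl

variable [LieGroup 𝓘(ℝ, E) ∞ G]

theorem tau_mul (hB : B.Nondegenerate) (g h : G) (X : LieAlg E G) :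
    tau hB (g * h) X = tau hB g (tau hB h X) :=
  eq_of_bilinForm_eq hB fun z => by rw [form_tau, form_tau, form_tau, mul_inv_rev, Ad_mul]

theorem tau_one (hB : B.Nondegenerate) (X : LieAlg E G) : tau hB (1 : G) X = X :=
  eq_of_bilinForm_eq hB fun z => by rw [form_tau, inv_one, Ad_one]

theorem grad_tau (hB : B.Nondegenerate) (hs : B.IsSymm) {f : LieAlg E G → ℝ} (hf : IsSmooth f)
    (hτ : IsTauInvariant hB f) (g : G) (U : LieAlg E G) :
    grad hB f (tau hB g U) = Ad g (grad hB f U) := by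
  have hfderiv (W : LieAlg E G) : fderiv ℝ f (tau hB g U) (tau hB g W) = fderiv ℝ f U W :=
    fderiv_apply_of_comp_linearMap_eq (V := E) (ContDiff.differentiable hf (by simp)) (tau hB g)
      (hτ g) U W
  suffices h : Ad g⁻¹ (grad hB f (tau hB g U)) = grad hB f U by rw [← h, Ad_Ad_inv]
  refine eq_of_bilinForm_eq hB fun W => ?_
  rw [hs.eq, ← form_tau hB, hs.eq, form_grad, hfderiv, form_grad]

variable [CompleteSpace E]

theorem form_adT (hB : B.Nondegenerate) (X Y Z : LieAlg E G) :
    B (adT hB X Y) Z = B Y ⁅X, Z⁆ :=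
  LinearMap.BilinForm.isAdjointPairLeftAdjointOfNondegenerate B hB _ Y Z

theorem adT_add (hB : B.Nondegenerate) (X Y U : LieAlg E G) :
    adT hB (X + Y) U = adT hB X U + adT hB Y U :=
  eq_of_bilinForm_eq hB fun z => by
    rw [map_add, LinearMap.add_apply, form_adT, form_adT, form_adT, add_lie, map_add]

theorem adT_smul (hB : B.Nondegenerate) (c : ℝ) (X U : LieAlg E G) :
    adT hB (c • X) U = c • adT hB X U :=
  eq_of_bilinForm_eq hB fun z => by
    rw [map_smul, LinearMap.smul_apply, form_adT, form_adT, smul_lie, map_smul]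

/-- The transpose of the adjoint representation, `(X, U) ↦ adᵗ_X U`, as a bilinear map. -/
def adTBilin (hB : B.Nondegenerate) : LieAlg E G →ₗ[ℝ] LieAlg E G →ₗ[ℝ] LieAlg E G :=
  LinearMap.mk₂ ℝ (fun X U => adT hB X U) (adT_add hB) (adT_smul hB)
    (fun X => map_add (adT hB X)) (fun c X => map_smul (adT hB X) c)

theorem contDiff_neg_adT_grad (hB : B.Nondegenerate) {f : LieAlg E G → ℝ} (hf : IsSmooth f)
    (L : LieAlg E G →ₗ[ℝ] LieAlg E G) :
    ContDiff (E := E) (F := E) ℝ ∞ (fun U => -adT hB (L (grad hB f U)) U) := by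
  have hgrad : ContDiff (E := E) (F := E) ℝ ∞ (fun U => L (grad hB f U)) :=
    contDiff_linearMap_fderiv (V := E) (W := E) (hf.of_le (by simp))
      (L ∘ₗ (B.toDual hB).symm.toLinearMap)
  exact (contDiff_bilinear_apply (V := E) (W := E) (adTBilin hB) hgrad contDiff_id).neg

theorem HasVelocityAtOne.hasDerivAt_tau (hB : B.Nondegenerate) {γ : ℝ → G} {ξ : LieAlg E G}
    {t₀ : ℝ} (h : HasVelocityAtOne γ ξ t₀) (W : LieAlg E G) :
    HasDerivAt (fun t => tau hB (γ t) W) (-adT hB ξ W) t₀ := by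
  have hform (Z : LieAlg E G) : B (-adT hB ξ W) Z = B W ⁅-ξ, Z⁆ := by
    rw [map_neg, LinearMap.neg_apply, form_adT, neg_lie, map_neg]
  have hAd (Z : LieAlg E G) :
      HasDerivAt (fun t => B (tau hB (γ t) W) Z) (B (-adT hB ξ W) Z) t₀ := by
    simp only [form_tau, hform]
    exact hasDerivAt_linearMap_apply (V := E) (B W) (h.inv.hasDerivAt_Ad Z)
  exact hasDerivAt_of_bilinForm (V := E) hB hAd

/-- Obtained by differentiating `f (τ(γ t) U) = f U` along a curve `γ` with velocity `Y`. -/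
theorem adT_grad_self (hB : B.Nondegenerate) (hs : B.IsSymm) {f : LieAlg E G → ℝ}
    (hf : IsSmooth f) (hτ : IsTauInvariant hB f) (U : LieAlg E G) :
    adT hB (grad hB f U) U = 0 := by
  refine eq_of_bilinForm_eq hB fun Y => ?_
  obtain ⟨γ, hγ⟩ := exists_hasVelocityAtOne Y 0
  have hderiv := hf.hasDerivAt_comp (hγ.hasDerivAt_tau hB U)
  simp only [hτ _ U, hγ.eq_one, tau_one] at hderiv
  have hzero := hderiv.unique (hasDerivAt_const 0 (f U))
  rw [← form_grad hB, map_neg, neg_eq_zero, hs.eq, form_adT] at hzero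
  rw [form_adT, ← lie_skew, map_neg, hzero, map_zero, LinearMap.zero_apply, neg_zero]

variable [T2Space G]

theorem hasDerivAt_tau_exp (hB : B.Nondegenerate) (X U : LieAlg E G) (t : ℝ) :
    HasDerivAt (fun s : ℝ => tau hB (exp (s • X)) U) (-tau hB (exp (t • X)) (adT hB X U)) t := by
  have hvel : HasVelocityAtOne (fun s => exp ((1 * s + -t) • X)) ((1 : ℝ) • X) t :=
    (isOneParam_exp X).hasVelocityAtOne.comp_affine 1 (-t) (by ring)
  have hderiv := hasDerivAt_linearMap_apply (V := E) (W := E) (tau hB (exp (t • X)))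
    (hvel.hasDerivAt_tau hB U)
  have hmul (s : ℝ) : tau hB (exp (t • X)) (tau hB (exp ((1 * s + -t) • X)) U) =
      tau hB (exp (s • X)) U := by
    rw [← tau_mul, ← exp_add_smul, one_mul, add_comm s, add_neg_cancel_left]
  have hval : tau hB (exp (t • X)) (-adT hB ((1 : ℝ) • X) U) =
      -tau hB (exp (t • X)) (adT hB X U) := by
    rw [one_smul, map_neg]
  exact (funext hmul ▸ hderiv).congr_deriv hval

theorem tau_exp_eq_self (hB : B.Nondegenerate) {X U : LieAlg E G} (h : adT hB X U = 0) (s : ℝ) :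
    tau hB (exp (s • X)) U = U := by
  have hderiv (t : ℝ) : HasDerivAt (F := E) (fun s : ℝ => tau hB (exp (s • X)) U) 0 t := by
    have := hasDerivAt_tau_exp hB X U t
    rwa [h, map_zero, neg_zero] at this
  have hconst : tau hB (exp (s • X)) U = tau hB (exp ((0 : ℝ) • X)) U :=
    is_const_of_deriv_eq_zero (fun t => (hderiv t).differentiableAt)
      (fun t => (hderiv t).deriv) s 0
  simpa only [exp_zero_smul, tau_one] using hconst

end Form

namespace IsLieSubgroup

variable {E : Type*} [NormedAddCommGroup E] [NormedSpace ℝ E] [CompleteSpace E]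
  {G : Type*} [TopologicalSpace G] [ChartedSpace E G] [Group G] [LieGroup 𝓘(ℝ, E) ∞ G]
  {F : Type*} [NormedAddCommGroup F] [NormedSpace ℝ F]
  {K : Type*} [TopologicalSpace K] [ChartedSpace F K] [Group K]
  {ι : K →* G} {𝔥 : LieSubalgebra ℝ (LieAlg E G)}

theorem differential_mem (hι : IsLieSubgroup (F := F) ι 𝔥) (X : LieAlg F K) :
    differential (E := E) ι X ∈ 𝔥 :=
  (hι.range_differential.le :
    LinearMap.range (differential (E := E) (F := F) ι) ≤ 𝔥.toSubmodule) ⟨X, rfl⟩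

theorem exists_differential_eq (hι : IsLieSubgroup (F := F) ι 𝔥) {X : LieAlg E G} (hX : X ∈ 𝔥) :
    ∃ Y : LieAlg F K, differential (E := E) ι Y = X :=
  (hι.range_differential.ge :
    𝔥.toSubmodule ≤ LinearMap.range (differential (E := E) (F := F) ι)) hX

theorem Ad_mem [LieGroup 𝓘(ℝ, F) ∞ K] (hι : IsLieSubgroup (F := F) ι 𝔥) (k : K)
    {X : LieAlg E G} (hX : X ∈ 𝔥) : Ad (ι k) X ∈ 𝔥 := by
  obtain ⟨Y, rfl⟩ := hι.exists_differential_eq hX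
  rw [← differential_Ad ι hι.contMDiff]
  exact hι.differential_mem _

end IsLieSubgroup

namespace Splitting

variable {E : Type*} [NormedAddCommGroup E] [NormedSpace ℝ E] [FiniteDimensional ℝ E]
  [CompleteSpace E]
  {G : Type*} [TopologicalSpace G] [ChartedSpace E G] [Group G] [LieGroup 𝓘(ℝ, E) ∞ G]
  {Em : Type*} [NormedAddCommGroup Em] [NormedSpace ℝ Em]
  {Gm : Type*} [TopologicalSpace Gm] [ChartedSpace Em Gm] [Group Gm]
  (D : Splitting E G Em Gm)

section GradientComponents

variable (f : LieAlg E G → ℝ) (U : LieAlg E G)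

theorem gradPlus_mem : D.gradPlus f U ∈ D.gp :=
  Submodule.projection_apply_mem D.isCompl _

theorem gradMinus_mem : D.gradMinus f U ∈ D.gm :=
  Submodule.projection_apply_mem D.isCompl.symm _

theorem exists_dIncl_eq_gradMinus : ∃ Y : LieAlg Em Gm, D.dIncl Y = D.gradMinus f U :=
  D.isLieSubgroup.exists_differential_eq (D.gradMinus_mem f U)

theorem gradPlus_add_gradMinus : D.gradPlus f U + D.gradMinus f U = grad D.nondeg f U :=
  Submodule.projection_add_projection_eq_self D.isCompl _

variable {f U}

theorem gradPlus_eq_of_add_eq {X Y : LieAlg E G} (hX : X ∈ D.gp) (hY : Y ∈ D.gm)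
    (h : X + Y = grad D.nondeg f U) : D.gradPlus f U = X := by
  rw [gradPlus, ← h, map_add, Submodule.projection_apply_of_mem_left D.isCompl hX,
    Submodule.projection_apply_of_mem_right D.isCompl hY, add_zero]

theorem adT_gradMinus_eq (hf : IsSmooth f) (hτ : IsTauInvariant D.nondeg f) (U : LieAlg E G) :
    adT D.nondeg (D.gradMinus f U) U = -adT D.nondeg (D.gradPlus f U) U := by
  refine eq_neg_of_add_eq_zero_right ?_
  rw [← adT_add, gradPlus_add_gradMinus, adT_grad_self D.nondeg D.symm hf hτ]

end GradientComponents

section Perp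

variable {X U V : LieAlg E G}

omit [FiniteDimensional ℝ E] in
theorem mem_gpPerp_iff : U ∈ D.gpPerp ↔ ∀ X ∈ D.gp, D.form U X = 0 :=
  forall₂_congr fun X _ => by rw [D.symm.eq]

omit [FiniteDimensional ℝ E] in
theorem form_eq_zero_of_mem (hU : U ∈ D.gpPerp) (hX : X ∈ D.gp) : D.form U X = 0 :=
  D.mem_gpPerp_iff.1 hU X hX

theorem form_grad_eq_form_gradMinus (hV : V ∈ D.gpPerp) (f : LieAlg E G → ℝ) (U : LieAlg E G) :
    D.form V (grad D.nondeg f U) = D.form V (D.gradMinus f U) := by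
  rw [← D.gradPlus_add_gradMinus, map_add, D.form_eq_zero_of_mem hV (D.gradPlus_mem f U), zero_add]

theorem adT_mem_gpPerp (hX : X ∈ D.gp) (hU : U ∈ D.gpPerp) : adT D.nondeg X U ∈ D.gpPerp :=
  D.mem_gpPerp_iff.2 fun Y hY => by
    rw [form_adT]
    exact D.form_eq_zero_of_mem hU (D.gp.lie_mem hX hY)

variable [FiniteDimensional ℝ Em]

theorem projPerp_mem (X : LieAlg E G) : D.projPerp X ∈ D.gpPerp :=
  Submodule.projection_apply_mem D.isCompl_perp X

theorem projPerp_eq_self (hX : X ∈ D.gpPerp) : D.projPerp X = X :=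
  Submodule.projection_apply_of_mem_left D.isCompl_perp hX

theorem form_projPerp (X : LieAlg E G) (Y : LieAlg Em Gm) :
    D.form (D.projPerp X) (D.dIncl Y) = D.form X (D.dIncl Y) := by
  have hgmPerp : X - D.projPerp X ∈ D.gmPerp := by
    rw [projPerp, sub_eq_iff_eq_add'.2
      (Submodule.projection_add_projection_eq_self D.isCompl_perp X).symm]
    exact Submodule.projection_apply_mem D.isCompl_perp.symm X
  have hzero : D.form (D.dIncl Y) (X - D.projPerp X) = 0 :=
    hgmPerp _ (D.isLieSubgroup.differential_mem Y)
  rw [D.symm.eq, map_sub, LinearMap.sub_apply, sub_eq_zero] at hzero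
  exact hzero.symm

theorem eq_of_form_dIncl_eq (hU : U ∈ D.gpPerp) (hV : V ∈ D.gpPerp)
    (h : ∀ Y : LieAlg Em Gm, D.form U (D.dIncl Y) = D.form V (D.dIncl Y)) : U = V :=
  congrArg Subtype.val (D.ell_bijective.1 (a₁ := ⟨U, hU⟩) (a₂ := ⟨V, hV⟩) (LinearMap.ext h))

end Perp

variable [FiniteDimensional ℝ Em]

section OrbitAction

theorem form_tauTilde (g : Gm) (U : D.gpPerp) (Y : LieAlg Em Gm) :
    D.form (D.tauTilde g U) (D.dIncl Y) = D.form U (D.dIncl (Ad g⁻¹ Y)) :=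
  LinearMap.congr_fun (D.ellEquiv.apply_symm_apply (coAd g (D.ellEquiv U))) Y

variable [LieGroup 𝓘(ℝ, Em) ∞ Gm]

theorem tauTilde_mul (g h : Gm) (U : D.gpPerp) :
    D.tauTilde (g * h) U = D.tauTilde g (D.tauTilde h U) :=
  Subtype.ext (D.eq_of_form_dIncl_eq (Subtype.prop _) (Subtype.prop _) fun Y => by
    rw [form_tauTilde, form_tauTilde, form_tauTilde, mul_inv_rev, Ad_mul])

theorem tauTilde_mem_orbit {P U : D.gpPerp} (hU : U ∈ D.orbit P) (g : Gm) :
    D.tauTilde g U ∈ D.orbit P := by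
  obtain ⟨h, rfl⟩ := hU
  exact ⟨g * h, D.tauTilde_mul g h P⟩

theorem tauTilde_eq_projPerp (g : Gm) (U : D.gpPerp) :
    (D.tauTilde g U : LieAlg E G) = D.projPerp (tau D.nondeg (D.incl g) U) :=
  D.eq_of_form_dIncl_eq (Subtype.prop _) (D.projPerp_mem _) fun Y => by
    rw [form_tauTilde, form_projPerp, form_tau, ← map_inv, dIncl,
      differential_Ad D.incl D.isLieSubgroup.contMDiff]

variable [T2Space Gm] (Y Z : LieAlg Em Gm) (U : D.gpPerp)

theorem orbitCurve_zero : D.orbitCurve Y U 0 = U := by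
  have : CompleteSpace Em := FiniteDimensional.complete ℝ Em
  rw [orbitCurve, exp_zero_smul, tauTilde_eq_projPerp, map_one, tau_one,
    D.projPerp_eq_self U.2]

theorem hasDerivAt_orbitCurve_projPerp :
    HasDerivAt (D.orbitCurve Y U) (-D.projPerp (adT D.nondeg (D.dIncl Y) U)) 0 := by
  have : CompleteSpace Em := FiniteDimensional.complete ℝ Em
  have hcurve : D.orbitCurve Y U = fun s => D.projPerp (tau D.nondeg (D.incl (exp (s • Y))) U) :=
    funext fun s => D.tauTilde_eq_projPerp (exp (s • Y)) U
  rw [hcurve, ← map_neg]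
  exact hasDerivAt_linearMap_apply (V := E) (W := E) D.projPerp
    (((isOneParam_exp Y).hasVelocityAtOne.map D.incl
      D.isLieSubgroup.contMDiff).hasDerivAt_tau D.nondeg (U : LieAlg E G))

theorem infGen_eq : D.infGen Y U = -D.projPerp (adT D.nondeg (D.dIncl Y) U) :=
  HasDerivAt.deriv (F := E) (D.hasDerivAt_orbitCurve_projPerp Y U)

theorem hasDerivAt_orbitCurve : HasDerivAt (D.orbitCurve Y U) (D.infGen Y U) 0 :=
  D.infGen_eq Y U ▸ D.hasDerivAt_orbitCurve_projPerp Y U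

theorem infGen_mem_gpPerp : D.infGen Y U ∈ D.gpPerp := by
  rw [infGen_eq]
  exact D.gpPerp.neg_mem (D.projPerp_mem _)

theorem form_infGen :
    D.form (D.infGen Y U) (D.dIncl Z) = -D.form U ⁅D.dIncl Y, D.dIncl Z⁆ := by
  rw [infGen_eq, map_neg, LinearMap.neg_apply, form_projPerp, form_adT]

end OrbitAction

variable [LieGroup 𝓘(ℝ, Em) ∞ Gm] [T2Space Gm]

section OrbitForm

variable (U : D.gpPerp)

/-- The linear map `Y ↦ Ỹ(U)` from the Lie algebra of `G₋` onto the tangent space of the orbit,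
along which the orbit form is defined. -/
def tangentGenLinear : LieAlg Em Gm →ₗ[ℝ] D.tangent U where
  toFun Y := D.tangentGen Y U
  map_add' Y Z := by
    apply Subtype.ext
    change D.infGen (Y + Z) U = D.infGen Y U + D.infGen Z U
    rw [infGen_eq, infGen_eq, infGen_eq, map_add, adT_add, map_add, neg_add]
  map_smul' c Y := by
    apply Subtype.ext
    change D.infGen (c • Y) U = c • D.infGen Y U
    rw [infGen_eq, infGen_eq, map_smul, adT_smul, map_smul, smul_neg]

theorem tangentGenLinear_surjective : Function.Surjective (D.tangentGenLinear U) := by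
  have hle : D.tangent U ≤ LinearMap.range ((D.tangent U).subtype ∘ₗ D.tangentGenLinear U) :=
    Submodule.span_le.2 (Set.range_subset_iff.2 fun Y => ⟨Y, rfl⟩)
  rintro ⟨v, hv⟩
  obtain ⟨Y, hY⟩ := hle hv
  exact ⟨Y, Subtype.ext hY⟩

theorem form_lie_congr {Y Y' Z Z' : LieAlg Em Gm} (hY : D.infGen Y U = D.infGen Y' U)
    (hZ : D.infGen Z U = D.infGen Z' U) :
    D.form U ⁅D.dIncl Y, D.dIncl Z⁆ = D.form U ⁅D.dIncl Y', D.dIncl Z'⁆ := by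
  rw [← neg_inj, ← form_infGen, hY, form_infGen, ← map_neg, ← map_neg, lie_skew, lie_skew,
    ← neg_inj, ← form_infGen, hZ, form_infGen]

theorem exists_isOrbitForm : ∃ Ω, D.IsOrbitForm U Ω := by
  obtain ⟨r, hr⟩ := LinearMap.exists_rightInverse_of_surjective (D.tangentGenLinear U)
    (LinearMap.range_eq_top.2 (D.tangentGenLinear_surjective U))
  have hinfGen (v : D.tangent U) : D.infGen (r v) U = v :=
    congrArg Subtype.val (LinearMap.congr_fun hr v)
  refine ⟨LinearMap.mk₂ ℝ (fun v w => D.form U ⁅D.dIncl (r v), D.dIncl (r w)⁆)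
    (fun _ _ _ => by simp only [map_add, add_lie]) (fun _ _ _ => by simp only [map_smul, smul_lie])
    (fun _ _ _ => by simp only [map_add, lie_add])
    (fun _ _ _ => by simp only [map_smul, lie_smul]), fun Y Z => ?_⟩
  rw [LinearMap.mk₂_apply]
  exact D.form_lie_congr U (hinfGen _) (hinfGen _)

theorem isOrbitForm_orbitForm : D.IsOrbitForm U (D.orbitForm U) :=
  Classical.epsilon_spec (D.exists_isOrbitForm U)

theorem orbitForm_tangentGen (Y Z : LieAlg Em Gm) :
    D.orbitForm U (D.tangentGen Y U) (D.tangentGen Z U) = -D.form (D.infGen Y U) (D.dIncl Z) := by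
  rw [D.isOrbitForm_orbitForm U, form_infGen, neg_neg]

theorem orbitForm_isAlt : (D.orbitForm U).IsAlt := by
  intro v
  obtain ⟨Y, rfl⟩ := D.tangentGenLinear_surjective U v
  exact (D.isOrbitForm_orbitForm U Y Y).trans (by rw [lie_self, map_zero])

theorem orbitForm_nondegenerate : (D.orbitForm U).Nondegenerate := by
  have hleft (v : D.tangent U) (hv : ∀ w, D.orbitForm U v w = 0) : v = 0 := by
    obtain ⟨Y, rfl⟩ := D.tangentGenLinear_surjective U v
    refine Subtype.ext (D.eq_of_form_dIncl_eq (D.infGen_mem_gpPerp Y U) D.gpPerp.zero_mem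
      fun Z => ?_)
    have horth : D.orbitForm U (D.tangentGen Y U) (D.tangentGen Z U) = 0 := hv _
    rw [orbitForm_tangentGen, neg_eq_zero] at horth
    exact horth.trans (LinearMap.map_zero₂ D.form _).symm
  exact ⟨hleft, fun w hw => hleft w fun v => by
    rw [← LinearMap.IsAlt.neg (D.orbitForm_isAlt U), hw, neg_zero]⟩

end OrbitForm

section HamiltonianField

variable {f : LieAlg E G → ℝ} {U : D.gpPerp}

theorem deriv_comp_orbitCurve (hf : IsSmooth f) (Y : LieAlg Em Gm) (U : D.gpPerp) :
    deriv (fun s => f (D.orbitCurve Y U s)) 0 = D.form (D.infGen Y U) (D.gradMinus f U) := by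
  rw [(hf.hasDerivAt_comp (D.hasDerivAt_orbitCurve Y U)).deriv, orbitCurve_zero,
    ← form_grad D.nondeg, D.symm.eq, D.form_grad_eq_form_gradMinus (D.infGen_mem_gpPerp Y U)]

theorem isHamiltonianVector_neg_tangentGen (hf : IsSmooth f) {Z : LieAlg Em Gm}
    (hZ : D.dIncl Z = D.gradMinus f U) : D.IsHamiltonianVector f U (-D.tangentGen Z U) := by
  intro Y
  rw [D.deriv_comp_orbitCurve hf, map_neg, orbitForm_tangentGen, neg_neg, hZ]

theorem eq_of_isHamiltonianVector {X X' : D.tangent U} (h : D.IsHamiltonianVector f U X)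
    (h' : D.IsHamiltonianVector f U X') : X = X' := by
  refine sub_eq_zero.1 ((D.orbitForm_nondegenerate U).2 _ fun v => ?_)
  obtain ⟨Y, rfl⟩ := D.tangentGenLinear_surjective U v
  rw [map_sub, sub_eq_zero]
  exact (h Y).symm.trans (h' Y)

theorem existsUnique_isHamiltonianVector (hf : IsSmooth f) (U : D.gpPerp) :
    ∃! X : D.tangent U, D.IsHamiltonianVector f U X := by
  obtain ⟨Z, hZ⟩ := D.exists_dIncl_eq_gradMinus f U
  have h := D.isHamiltonianVector_neg_tangentGen hf hZ
  exact ⟨_, h, fun X hX => D.eq_of_isHamiltonianVector hX h⟩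

theorem isHamiltonianVector_hamiltonianField (hf : IsSmooth f) (U : D.gpPerp) :
    D.IsHamiltonianVector f U (D.hamiltonianField f U) :=
  Classical.epsilon_spec (D.existsUnique_isHamiltonianVector hf U).exists

theorem hamiltonianField_eq_neg_tangentGen (hf : IsSmooth f) {Z : LieAlg Em Gm}
    (hZ : D.dIncl Z = D.gradMinus f U) : D.hamiltonianField f U = -D.tangentGen Z U :=
  D.eq_of_isHamiltonianVector (D.isHamiltonianVector_hamiltonianField hf U)
    (D.isHamiltonianVector_neg_tangentGen hf hZ)

theorem exists_hamiltonianField_eq_neg_infGen (hf : IsSmooth f) (U : D.gpPerp) :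
    ∃ Y : LieAlg Em Gm, D.dIncl Y = D.gradMinus f U ∧
      (D.hamiltonianField f U : LieAlg E G) = -D.infGen Y U := by
  obtain ⟨Y, hY⟩ := D.exists_dIncl_eq_gradMinus f U
  exact ⟨Y, hY, congrArg Subtype.val (D.hamiltonianField_eq_neg_tangentGen hf hY)⟩

theorem hamiltonianField_eq_projPerp (hf : IsSmooth f) (U : D.gpPerp) :
    (D.hamiltonianField f U : LieAlg E G) = D.projPerp (adT D.nondeg (D.gradMinus f U) U) := by
  obtain ⟨Y, hY, hfield⟩ := D.exists_hamiltonianField_eq_neg_infGen hf U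
  rw [hfield, infGen_eq, neg_neg, hY]

theorem hamiltonianField_eq_neg_adT_gradPlus (hf : IsSmooth f) (hτ : IsTauInvariant D.nondeg f)
    (U : D.gpPerp) :
    (D.hamiltonianField f U : LieAlg E G) = -adT D.nondeg (D.gradPlus f U) U := by
  rw [D.hamiltonianField_eq_projPerp hf, D.adT_gradMinus_eq hf hτ]
  exact D.projPerp_eq_self (D.gpPerp.neg_mem (D.adT_mem_gpPerp (D.gradPlus_mem f U) U.2))

theorem hamiltonianField_eq_adT_gradMinus (hf : IsSmooth f) (hτ : IsTauInvariant D.nondeg f)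
    (U : D.gpPerp) :
    (D.hamiltonianField f U : LieAlg E G) = adT D.nondeg (D.gradMinus f U) U := by
  rw [D.hamiltonianField_eq_neg_adT_gradPlus hf hτ, D.adT_gradMinus_eq hf hτ]

theorem poissonBracket_eq_form_lie {f₁ f₂ : LieAlg E G → ℝ} (hf₁ : IsSmooth f₁)
    (hf₂ : IsSmooth f₂) (U : D.gpPerp) :
    D.poissonBracket f₁ f₂ U = D.form U ⁅D.gradMinus f₁ U, D.gradMinus f₂ U⁆ := by
  obtain ⟨Y, hY⟩ := D.exists_dIncl_eq_gradMinus f₁ U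
  obtain ⟨Z, hZ⟩ := D.exists_dIncl_eq_gradMinus f₂ U
  rw [poissonBracket, D.hamiltonianField_eq_neg_tangentGen hf₁ hY,
    D.hamiltonianField_eq_neg_tangentGen hf₂ hZ, map_neg, map_neg, LinearMap.neg_apply, neg_neg,
    D.isOrbitForm_orbitForm U, hY, hZ]

theorem poissonBracket_eq_zero {f₁ f₂ : LieAlg E G → ℝ} (hf₁ : IsSmooth f₁) (hf₂ : IsSmooth f₂)
    (hτ₁ : IsTauInvariant D.nondeg f₁) (hτ₂ : IsTauInvariant D.nondeg f₂) (U : D.gpPerp) :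
    D.poissonBracket f₁ f₂ U = 0 :=
  have hmem : adT D.nondeg (D.gradPlus f₂ U) U ∈ D.gpPerp :=
    D.adT_mem_gpPerp (D.gradPlus_mem f₂ U) U.2
  calc D.poissonBracket f₁ f₂ U
    _ = D.form (adT D.nondeg (D.gradMinus f₁ U) U) (D.gradMinus f₂ U) := by
      rw [D.poissonBracket_eq_form_lie hf₁ hf₂, form_adT]
    _ = D.form U ⁅D.gradMinus f₂ U, D.gradPlus f₁ U⁆ := by
      rw [D.adT_gradMinus_eq hf₁ hτ₁, map_neg, LinearMap.neg_apply, form_adT, ← map_neg, lie_skew]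
    _ = -D.form (adT D.nondeg (D.gradPlus f₂ U) U) (D.gradPlus f₁ U) := by
      rw [← form_adT D.nondeg, D.adT_gradMinus_eq hf₂ hτ₂, map_neg, LinearMap.neg_apply]
    _ = 0 := by rw [D.form_eq_zero_of_mem hmem (D.gradPlus_mem f₁ U), neg_zero]

end HamiltonianField

end Splitting

section LogarithmicDerivative

variable {E : Type*} [NormedAddCommGroup E] [NormedSpace ℝ E]
  {G : Type*} [TopologicalSpace G] [ChartedSpace E G] [Group G] [LieGroup 𝓘(ℝ, E) ∞ G]

theorem exists_hasVelocityAtOne_mul_inv {γ : ℝ → G} {s : ℝ}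
    (hγ : MDifferentiableAt 𝓘(ℝ, ℝ) 𝓘(ℝ, E) γ s) :
    ∃ ξ : LieAlg E G, HasVelocityAtOne (fun t => γ t * (γ s)⁻¹) ξ s :=
  exists_hasVelocityAtOne_of_mdifferentiableAt (mul_inv_cancel (γ s))
    (MDifferentiableAt.comp s (g := fun x : G => x * (γ s)⁻¹)
      ((contMDiff_mul_right (I := 𝓘(ℝ, E)) (n := ∞)).mdifferentiable (by simp) _) hγ)

theorem HasVelocityAtOne.hasDerivAt_tau_of_mul_inv [FiniteDimensional ℝ E] [CompleteSpace E]
    {B : LinearMap.BilinForm ℝ (LieAlg E G)} (hB : B.Nondegenerate) {γ : ℝ → G}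
    {ξ : LieAlg E G} {s : ℝ} (h : HasVelocityAtOne (fun t => γ t * (γ s)⁻¹) ξ s)
    (W : LieAlg E G) :
    HasDerivAt (fun t => tau hB (γ t) W) (-adT hB ξ (tau hB (γ s) W)) s := by
  have hmul (t : ℝ) : tau hB (γ t * (γ s)⁻¹) (tau hB (γ s) W) = tau hB (γ t) W := by
    rw [← tau_mul, inv_mul_cancel_right]
  simpa only [hmul] using h.hasDerivAt_tau hB (tau hB (γ s) W)

end LogarithmicDerivative

namespace Splitting

variable {E : Type*} [NormedAddCommGroup E] [NormedSpace ℝ E] [FiniteDimensional ℝ E]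
  [CompleteSpace E]
  {G : Type*} [TopologicalSpace G] [ChartedSpace E G] [Group G] [LieGroup 𝓘(ℝ, E) ∞ G]
  {Ep : Type*} [NormedAddCommGroup Ep] [NormedSpace ℝ Ep]
  {Gp : Type*} [TopologicalSpace Gp] [ChartedSpace Ep Gp] [Group Gp]
  {Em : Type*} [NormedAddCommGroup Em] [NormedSpace ℝ Em]
  {Gm : Type*} [TopologicalSpace Gm] [ChartedSpace Em Gm] [Group Gm]
  (D : Splitting E G Em Gm)

section Factorization

variable {f : LieAlg E G → ℝ}

theorem eqOn_Ioo_of_hasDerivAt (hf : IsSmooth f) {u v : ℝ → LieAlg E G} {a b t₀ : ℝ}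
    (ht₀ : t₀ ∈ Set.Ioo a b)
    (hu : ∀ s ∈ Set.Ioo a b, HasDerivAt u (-adT D.nondeg (D.gradPlus f (u s)) (u s)) s)
    (hv : ∀ s ∈ Set.Ioo a b, HasDerivAt v (-adT D.nondeg (D.gradPlus f (v s)) (v s)) s)
    (h : u t₀ = v t₀) : Set.EqOn u v (Set.Ioo a b) :=
  eqOn_Ioo_of_hasDerivAt_of_contDiff (E := E)
    ((contDiff_neg_adT_grad D.nondeg hf
      (D.gp.toSubmodule.projection D.gm.toSubmodule D.isCompl)).of_le (by simp)) ht₀ hu hv h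

variable {inclp : Gp →* G}
  (hinclp : IsLieSubgroup (F := Ep) inclp D.gp)
include hinclp

theorem tau_mem_gpPerp [LieGroup 𝓘(ℝ, Ep) ∞ Gp] (g : Gp) {U : LieAlg E G} (hU : U ∈ D.gpPerp) :
    tau D.nondeg (inclp g) U ∈ D.gpPerp :=
  D.mem_gpPerp_iff.2 fun X hX => by
    rw [form_tau, ← map_inv]
    exact D.form_eq_zero_of_mem hU (hinclp.Ad_mem g⁻¹ hX)

variable [T2Space G] (hf : IsSmooth f) (hτ : IsTauInvariant D.nondeg f)
include hf hτ

/-- Comparing the velocities of both sides of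
`k t * (k s)⁻¹ = (h t * (h s)⁻¹) * (h s * exp ((s - t) • ∇f(U₀)) * (h s)⁻¹)` at `t = s`, and using
`∇f(τ(h s) U₀) = Ad (h s) ∇f(U₀)`. -/
theorem gradPlus_tau_of_factorization {U₀ : LieAlg E G} {h : ℝ → Gp} {k : ℝ → Gm}
    (hhk : ∀ t, D.incl (k t) = inclp (h t) * exp (-t • grad D.nondeg f U₀)) {s : ℝ}
    {η : LieAlg Ep Gp} (hη : HasVelocityAtOne (fun t => h t * (h s)⁻¹) η s)
    {κ : LieAlg Em Gm} (hκ : HasVelocityAtOne (fun t => k t * (k s)⁻¹) κ s) :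
    D.gradPlus f (tau D.nondeg (inclp (h s)) U₀) = differential inclp η := by
  have hexp : HasVelocityAtOne (fun t => exp ((-1 * t + s) • grad D.nondeg f U₀))
      ((-1 : ℝ) • grad D.nondeg f U₀) s :=
    (isOneParam_exp _).hasVelocityAtOne.comp_affine (-1) s (by ring)
  have hprod := (hη.map inclp hinclp.contMDiff).mul (hexp.conj (inclp (h s)))
  have heq (t : ℝ) : inclp (h t * (h s)⁻¹) *
      (inclp (h s) * exp ((-1 * t + s) • grad D.nondeg f U₀) * (inclp (h s))⁻¹) =
      D.incl (k t * (k s)⁻¹) := by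
    rw [map_mul, map_mul, map_inv, map_inv, hhk, hhk, exp_add_smul, exp_neg_smul _ s, neg_one_mul]
    group
  simp only [heq] at hprod
  refine D.gradPlus_eq_of_add_eq (hinclp.differential_mem η)
    (D.gm.neg_mem (D.isLieSubgroup.differential_mem κ)) ?_
  rw [(hκ.map D.incl D.isLieSubgroup.contMDiff).unique hprod,
    grad_tau D.nondeg D.symm hf hτ, neg_one_smul, map_neg]
  abel

theorem hasDerivAt_tau_of_factorization [LieGroup 𝓘(ℝ, Ep) ∞ Gp] [LieGroup 𝓘(ℝ, Em) ∞ Gm]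
    {U₀ : LieAlg E G} {h : ℝ → Gp} {k : ℝ → Gm} {s : ℝ}
    (hh : MDifferentiableAt 𝓘(ℝ, ℝ) 𝓘(ℝ, Ep) h s) (hk : MDifferentiableAt 𝓘(ℝ, ℝ) 𝓘(ℝ, Em) k s)
    (hhk : ∀ t, D.incl (k t) = inclp (h t) * exp (-t • grad D.nondeg f U₀)) :
    HasDerivAt (fun t => tau D.nondeg (inclp (h t)) U₀)
      (-adT D.nondeg (D.gradPlus f (tau D.nondeg (inclp (h s)) U₀))
        (tau D.nondeg (inclp (h s)) U₀)) s := by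
  obtain ⟨η, hη⟩ := exists_hasVelocityAtOne_mul_inv hh
  obtain ⟨κ, hκ⟩ := exists_hasVelocityAtOne_mul_inv hk
  rw [D.gradPlus_tau_of_factorization hinclp hf hτ hhk hη hκ]
  have hvel := hη.map inclp hinclp.contMDiff
  simp only [map_mul, map_inv] at hvel
  exact hvel.hasDerivAt_tau_of_mul_inv D.nondeg U₀

theorem tauTilde_eq_tau_of_factorization [FiniteDimensional ℝ Em]
    [LieGroup 𝓘(ℝ, Ep) ∞ Gp] [LieGroup 𝓘(ℝ, Em) ∞ Gm] {U₀ : D.gpPerp} {h : Gp} {k : Gm} {s : ℝ}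
    (hhk : D.incl k = inclp h * exp (s • grad D.nondeg f U₀)) :
    (D.tauTilde k U₀ : LieAlg E G) = tau D.nondeg (inclp h) U₀ := by
  rw [tauTilde_eq_projPerp, hhk, tau_mul,
    tau_exp_eq_self D.nondeg (adT_grad_self D.nondeg D.symm hf hτ _),
    D.projPerp_eq_self (D.tau_mem_gpPerp hinclp h U₀.2)]

end Factorization

section FactorizationCurve

variable {inclp : Gp →* G} {Φ : Diffeomorph (𝓘(ℝ, Ep).prod 𝓘(ℝ, Em)) 𝓘(ℝ, E) (Gp × Gm) G ∞}
  {f : LieAlg E G → ℝ}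

/-- The curve `s ↦ τ(g₊(-s)⁻¹) U₀`, where `g₊(s)` is the first factor of
`exp (s ∇f(U₀)) = g₊(s) g₋(s)`. The factorization enters through the inverse of the multiplication
diffeomorphism `Φ` from `G₊ × G₋` to `G`. -/
def factorizationCurve (inclp : Gp →* G)
    (Φ : Diffeomorph (𝓘(ℝ, Ep).prod 𝓘(ℝ, Em)) 𝓘(ℝ, E) (Gp × Gm) G ∞)
    (f : LieAlg E G → ℝ) (U₀ : LieAlg E G) (s : ℝ) : LieAlg E G :=
  tau D.nondeg (inclp (Φ.symm (exp (-s • grad D.nondeg f U₀))).1)⁻¹ U₀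

variable {D} (hΦ : ∀ (a : Gp) (b : Gm), Φ (a, b) = inclp a * D.incl b)
include hΦ

omit [FiniteDimensional ℝ E] in
theorem eq_mul_iff {g : G} {a : Gp} {b : Gm} :
    g = inclp a * D.incl b ↔ a = (Φ.symm g).1 ∧ b = (Φ.symm g).2 := by
  rw [← hΦ, ← Prod.mk_inj, Prod.mk.eta, eq_comm]
  exact (Φ.toEquiv.eq_symm_apply).symm

omit [FiniteDimensional ℝ E] in
theorem incl_symm_snd (g : G) : D.incl (Φ.symm g).2 = inclp (Φ.symm g).1⁻¹ * g := by
  rw [map_inv, eq_inv_mul_iff_mul_eq, ← (eq_mul_iff hΦ).2 ⟨rfl, rfl⟩]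

variable [T2Space G] (U₀ : LieAlg E G)

theorem factorizationCurve_zero : D.factorizationCurve inclp Φ f U₀ 0 = U₀ := by
  have hone : (1 : Gp) = (Φ.symm 1).1 := ((eq_mul_iff hΦ (b := 1)).1 (by simp)).1
  rw [factorizationCurve, neg_zero, exp_zero_smul, ← hone, map_one, inv_one, tau_one]

variable [LieGroup 𝓘(ℝ, Ep) ∞ Gp] [LieGroup 𝓘(ℝ, Em) ∞ Gm]
  (hinclp : IsLieSubgroup (F := Ep) inclp D.gp) (hf : IsSmooth f)
  (hτ : IsTauInvariant D.nondeg f)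
include hinclp hf hτ

theorem hasDerivAt_factorizationCurve (s : ℝ) :
    HasDerivAt (D.factorizationCurve inclp Φ f U₀)
      (-adT D.nondeg (D.gradPlus f (D.factorizationCurve inclp Φ f U₀ s))
        (D.factorizationCurve inclp Φ f U₀ s)) s := by
  have hexp : MDifferentiable 𝓘(ℝ, ℝ) 𝓘(ℝ, E) fun t : ℝ => exp (t • grad D.nondeg f U₀) :=
    fun t => ((isOneParam_exp _).2 t).mdifferentiableAt
  have hfac : MDifferentiable 𝓘(ℝ, ℝ) (𝓘(ℝ, Ep).prod 𝓘(ℝ, Em)) fun t : ℝ =>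
      Φ.symm (exp (-t • grad D.nondeg f U₀)) :=
    (Φ.symm.contMDiff.mdifferentiable (by simp)).comp
      (hexp.comp differentiable_neg.mdifferentiable)
  have hh := ((contMDiff_inv 𝓘(ℝ, Ep) ∞).mdifferentiable (by simp)).comp
    (mdifferentiable_fst.comp hfac)
  have hk := mdifferentiable_snd.comp hfac
  have hderiv := D.hasDerivAt_tau_of_factorization hinclp hf hτ (hh s) (hk s)
    fun t => incl_symm_snd hΦ _
  simp only [Function.comp_apply, map_inv] at hderiv
  exact hderiv

theorem exists_mem_orbit_eq_factorizationCurve [FiniteDimensional ℝ Em] {P U₀ : D.gpPerp}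
    (hU₀ : U₀ ∈ D.orbit P) (s : ℝ) :
    ∃ U ∈ D.orbit P, (U : LieAlg E G) = D.factorizationCurve inclp Φ f U₀ s :=
  ⟨_, D.tauTilde_mem_orbit hU₀ _, by
    rw [D.tauTilde_eq_tau_of_factorization hinclp hf hτ (incl_symm_snd hΦ _), map_inv,
      factorizationCurve]⟩

end FactorizationCurve

end Splitting

end Transadjoint

end

theorem theorem3
    {E : Type*} [NormedAddCommGroup E] [NormedSpace ℝ E] [FiniteDimensional ℝ E] [CompleteSpace E]
    {G : Type*} [TopologicalSpace G] [T2Space G] [ChartedSpace E G] [Group G]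
    [LieGroup 𝓘(ℝ, E) ∞ G]
    {Ep : Type*} [NormedAddCommGroup Ep] [NormedSpace ℝ Ep] [FiniteDimensional ℝ Ep]
    {Gp : Type*} [TopologicalSpace Gp] [T2Space Gp] [ChartedSpace Ep Gp] [Group Gp]
    [LieGroup 𝓘(ℝ, Ep) ∞ Gp]
    {Em : Type*} [NormedAddCommGroup Em] [NormedSpace ℝ Em] [FiniteDimensional ℝ Em]
    {Gm : Type*} [TopologicalSpace Gm] [T2Space Gm] [ChartedSpace Em Gm] [Group Gm]
    [LieGroup 𝓘(ℝ, Em) ∞ Gm]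
    (D : Transadjoint.Splitting E G Em Gm)
    (inclp : Gp →* G) (hinclp : Transadjoint.IsLieSubgroup (F := Ep) inclp D.gp)
    (P : D.gpPerp) (f : Transadjoint.LieAlg E G → ℝ) (hf : Transadjoint.IsSmooth f) :
    -- the orbit symplectic form exists, and is alternating and nondegenerate
    (∀ U ∈ D.orbit P,
      (∀ Y : Transadjoint.LieAlg Em Gm, HasDerivAt (D.orbitCurve Y U) (D.infGen Y U) 0) ∧
      D.IsOrbitForm U (D.orbitForm U) ∧ (D.orbitForm U).IsAlt ∧ (D.orbitForm U).Nondegenerate) ∧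
    -- (1)
    (∀ U ∈ D.orbit P,
      (∃! X : D.tangent U, D.IsHamiltonianVector f U X) ∧
      D.IsHamiltonianVector f U (D.hamiltonianField f U) ∧
      (∃ Y : Transadjoint.LieAlg Em Gm, D.dIncl Y = D.gradMinus f U ∧
        (D.hamiltonianField f U : Transadjoint.LieAlg E G) = - D.infGen Y U) ∧
      (D.hamiltonianField f U : Transadjoint.LieAlg E G) =
        D.projPerp (Transadjoint.adT D.nondeg (D.gradMinus f U) U)) ∧
    -- (2)
    (Transadjoint.IsTauInvariant D.nondeg f →
      ∀ U ∈ D.orbit P,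
        (D.hamiltonianField f U : Transadjoint.LieAlg E G) =
          - Transadjoint.adT D.nondeg (D.gradPlus f U) U ∧
        (D.hamiltonianField f U : Transadjoint.LieAlg E G) =
          Transadjoint.adT D.nondeg (D.gradMinus f U) U) ∧
    -- (3)
    (∀ f₁ f₂ : Transadjoint.LieAlg E G → ℝ,
      Transadjoint.IsSmooth f₁ → Transadjoint.IsSmooth f₂ →
      Transadjoint.IsTauInvariant D.nondeg f₁ → Transadjoint.IsTauInvariant D.nondeg f₂ →
      ∀ U ∈ D.orbit P, D.poissonBracket f₁ f₂ U = 0) ∧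
    -- (4)
    ((∃ Φ : Diffeomorph (𝓘(ℝ, Ep).prod 𝓘(ℝ, Em)) 𝓘(ℝ, E) (Gp × Gm) G ∞,
        ∀ (a : Gp) (b : Gm), Φ (a, b) = inclp a * D.incl b) →
      Transadjoint.IsTauInvariant D.nondeg f →
      ∀ U₀ ∈ D.orbit P,
        ∃ (gp : ℝ → Gp) (gm : ℝ → Gm),
          -- `(gp s, gm s)` is the unique factorization of `exp (s ∇f(U₀))`
          (∀ (s : ℝ) (a : Gp) (b : Gm),
            Transadjoint.exp (s • Transadjoint.grad D.nondeg f U₀) = inclp a * D.incl b ↔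
              a = gp s ∧ b = gm s) ∧
          ∃ u : ℝ → Transadjoint.LieAlg E G,
            (∀ s : ℝ, u s = Transadjoint.tau D.nondeg (inclp (gp (-s)))⁻¹ U₀) ∧
            u 0 = U₀ ∧
            (∀ s : ℝ, HasDerivAt u (- Transadjoint.adT D.nondeg (D.gradPlus f (u s)) (u s)) s) ∧
            (∀ s : ℝ, ∃ U ∈ D.orbit P, (U : Transadjoint.LieAlg E G) = u s) ∧
            -- it is the only solution, on every open interval around `0`
            (∀ (v : ℝ → Transadjoint.LieAlg E G) (a b : ℝ), a < 0 → 0 < b → v 0 = U₀ →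
              (∀ s ∈ Set.Ioo a b,
                HasDerivAt v (- Transadjoint.adT D.nondeg (D.gradPlus f (v s)) (v s)) s) →
              ∀ s ∈ Set.Ioo a b, v s = u s)) := by
  refine ⟨fun U _ => ⟨fun Y => D.hasDerivAt_orbitCurve Y U, D.isOrbitForm_orbitForm U,
      D.orbitForm_isAlt U, D.orbitForm_nondegenerate U⟩,
    fun U _ => ⟨D.existsUnique_isHamiltonianVector hf U,
      D.isHamiltonianVector_hamiltonianField hf U,
      D.exists_hamiltonianField_eq_neg_infGen hf U, D.hamiltonianField_eq_projPerp hf U⟩,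
    fun hτ U _ => ⟨D.hamiltonianField_eq_neg_adT_gradPlus hf hτ U,
      D.hamiltonianField_eq_adT_gradMinus hf hτ U⟩,
    fun f₁ f₂ hf₁ hf₂ hτ₁ hτ₂ U _ => D.poissonBracket_eq_zero hf₁ hf₂ hτ₁ hτ₂ U, ?_⟩
  rintro ⟨Φ, hΦ⟩ hτ U₀ hU₀
  let g (s : ℝ) : G := Transadjoint.exp (s • Transadjoint.grad D.nondeg f U₀)
  have hzero := Transadjoint.Splitting.factorizationCurve_zero (f := f) hΦ U₀
  have hderiv := Transadjoint.Splitting.hasDerivAt_factorizationCurve hΦ U₀ hinclp hf hτ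
  refine ⟨fun s => (Φ.symm (g s)).1, fun s => (Φ.symm (g s)).2,
    fun s a b => Transadjoint.Splitting.eq_mul_iff hΦ, D.factorizationCurve inclp Φ f U₀,
    fun s => rfl, hzero, hderiv,
    Transadjoint.Splitting.exists_mem_orbit_eq_factorizationCurve hΦ hinclp hf hτ hU₀, ?_⟩
  intro v a b ha hb hv₀ hv
  exact D.eqOn_Ioo_of_hasDerivAt hf ⟨ha, hb⟩ hv (fun s _ => hderiv s) (hv₀.trans hzero.symm)
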